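/- Write $L=\log(1/\delta)$ and, for $0<\delta\le e^{-e^{e}}$ (so that $\log\log\log(1/\delta)\ge 1$), write $$B(\varepsilon,\delta)=\frac1\varepsilon\left(\frac{\log(1/\delta)\,\log\log\log(1/\delta)}{\log\log(1/\delta)}\right)^2 .$$ There are universal constants $\gamma,\alpha,\beta,\rho,\tau>0$ and one fixed program $\mathcal P$ for a unit-cost random access machine with real arithmetic such that the following holds for all $0<\varepsilon,\delta<1$ with $\varepsilon\le \log^{-2}(1/\delta)$. There is a positive integer $c$ depending only on $\varepsilon,\delta$, with $c\le \beta\,B(\varepsilon,\delta)$ whenever $\delta\le e^{-e^{e}}$, such that for every dimension $d$, every integer $k\ge \alpha\,\varepsilon^{-2}L$ (for instance $k=\lceil\alpha\,\varepsilon^{-2}L\rceil$) and every integer $r\ge\rho L$ (for instance $r=\lceil\rho L\rceil$): Let $h\in[k]^{[d]\times[c]}$ and $\zeta\in\{-1,1\}^{[d]\times[c]}$ be random vectors, independent of each other, each with uniformly distributed and $r$-wise independent entries (such vectors exist), and let $\mathcal D$ be the distribution of the random $k\times d$ matrix $M$ with entries $$M_{t,j}=\frac1{\sqrt c}\sum_{a=1}^{c}\zeta_{(j,a)}\,\mathbf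 1_{\{h(j,a)=t\}} .$$ Then, for $M\sim\mathcal D$: 1. For every fixed $x\in\mathbb R^d$, $\;P\big((1-\varepsilon)\|x\|_2\le\|Mx\|_2\le(1+\varepsilon)\|x\|_2\big)\ge 1-\gamma\delta$. 2. Almost surely every column of $M$ has at most $c$ nonzero entries, and, if $\delta\le e^{-e^{e}}$, then almost surely, for every $x\in\mathbb R^d$, the program $\mathcal P$, given the nonzero entries of $M$ in compressed-column storage and the nonzero coordinates of $x$ as a list of index-value pairs, computes $Mx$ (into an array that is initially zero) in at most $\tau\,B(\varepsilon,\delta)\,\max(1,\|x\|_0)$ steps, where $\|x\|_0$ is the number of nonzero coordinates of $x$. In particular $M$ can be constructed from two vectors with $O(\log(1/\delta))$-wise independent entries. -/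

import Mathlib

open MeasureTheory ProbabilityTheory
open scoped ENNReal

noncomputable section

namespace SparseJL

/-! ### The random matrix -/

/-- `r`-wise independence of a family of random variables: every subfamily of at most `r`
members is (mutually) independent. -/
def WiseIndep {Ω ι β : Type*} [MeasurableSpace Ω] [MeasurableSpace β]
    (r : ℕ) (X : ι → Ω → β) (μ : Measure Ω) : Prop :=
  ∀ S : Finset ι, S.card ≤ r → iIndepFun (fun (i : S) (ω : Ω) => X i ω) μ

/-- A pair (hash vector `h` with entries in `[k]`, sign vector `s`), both indexed by `[d] × [c]`.
The sign `+1` is stored as `true` and `-1` as `false`. -/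
abbrev Seed (d k c : ℕ) : Type :=
  (Fin d × Fin c → Fin k) × (Fin d × Fin c → Bool)

/-- The law `ν` of a random pair `(h, s)` such that the vectors `h` and `s` are independent of each
other, each of them has `r`-wise independent entries, every entry of `h` is uniform on `[k]`, and
every entry of `s` is a uniform sign. -/
structure IsSeedLaw {d k c : ℕ} (r : ℕ) (ν : Measure (Seed d k c)) : Prop where
  prob : IsProbabilityMeasure ν
  hash_uniform : ∀ (e : Fin d × Fin c) (t : Fin k), ν {ω | ω.1 e = t} = (k : ℝ≥0∞)⁻¹
  sign_uniform : ∀ (e : Fin d × Fin c) (b : Bool), ν {ω | ω.2 e = b} = 2⁻¹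
  hash_wise : WiseIndep r (fun e (ω : Seed d k c) => ω.1 e) ν
  sign_wise : WiseIndep r (fun e (ω : Seed d k c) => ω.2 e) ν
  indep : IndepFun (fun ω : Seed d k c => ω.1) (fun ω : Seed d k c => ω.2) ν

/-- The real number `±1` that a Boolean stands for. -/
def sgn (b : Bool) : ℝ := if b then 1 else -1

/-- Duplicate every coordinate `c` times, rescale by `1 / √c`, and send the copy `(j, a)` with its
sign `s (j, a)` to the row `h (j, a)`. -/
def sparseMatrix {d k c : ℕ} (ω : Seed d k c) : Matrix (Fin k) (Fin d) ℝ :=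
  Matrix.of fun t j => (Real.sqrt c)⁻¹ * ∑ a : Fin c, if ω.1 (j, a) = t then sgn (ω.2 (j, a)) else 0

/-- Matrices carry the product sigma-algebra of their entries. -/
instance {d k : ℕ} : MeasurableSpace (Matrix (Fin k) (Fin d) ℝ) :=
  inferInstanceAs (MeasurableSpace (Fin k → Fin d → ℝ))

/-- The product `M x` as a vector of Euclidean space. -/
def apply {d k : ℕ} (M : Matrix (Fin k) (Fin d) ℝ) (x : EuclideanSpace ℝ (Fin d)) :
    EuclideanSpace ℝ (Fin k) :=
  WithLp.toLp 2 (M.mulVec x.ofLp)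

/-- The number `‖x‖₀` of nonzero coordinates. -/
def nnz {d : ℕ} (x : EuclideanSpace ℝ (Fin d)) : ℕ := Set.ncard {j : Fin d | x j ≠ 0}

/-- The number of nonzero entries of a column. -/
def colNnz {d k : ℕ} (M : Matrix (Fin k) (Fin d) ℝ) (j : Fin d) : ℕ :=
  Set.ncard {t : Fin k | M t j ≠ 0}

/-- `ε⁻¹ (log(1/δ) log log log(1/δ) / log log(1/δ))²`. -/
def sparsityBound (ε δ : ℝ) : ℝ :=
  ε⁻¹ * (Real.log (1 / δ) * Real.log (Real.log (Real.log (1 / δ)))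
    / Real.log (Real.log (1 / δ))) ^ 2

/-! ### A random access machine with real arithmetic and unit cost per instruction -/

/-- Instructions. There are natural-number registers, real registers, arrays of naturals and
arrays of reals; arrays are indexed by the contents of a natural-number register. -/
inductive Instr : Type
  /-- natural register `r` becomes the constant `v` -/
  | setN (r v : ℕ)
  /-- natural register `r` is increased by one -/
  | incN (r : ℕ)
  /-- natural register `r` becomes natural register `s` -/
  | movN (r s : ℕ)
  /-- natural register `r` becomes the cell of natural array `a` addressed by register `s` -/
  | loadN (r a s : ℕ)
  /-- the cell of natural array `a` addressed by register `s` becomes natural register `r` -/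
  | storeN (a s r : ℕ)
  /-- real register `r` becomes the cell of real array `a` addressed by natural register `s` -/
  | loadR (r a s : ℕ)
  /-- the cell of real array `a` addressed by natural register `s` becomes real register `r` -/
  | storeR (a s r : ℕ)
  /-- real register `r` becomes the sum of real registers `s` and `t` -/
  | addR (r s t : ℕ)
  /-- real register `r` becomes the difference of real registers `s` and `t` -/
  | subR (r s t : ℕ)
  /-- real register `r` becomes the product of real registers `s` and `t` -/
  | mulR (r s t : ℕ)
  /-- jump to line `l` if natural register `r` is smaller than natural register `s` -/
  | jltN (r s l : ℕ)
  /-- jump to line `l` -/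
  | jmp (l : ℕ)

/-- A configuration of the machine. -/
structure Config : Type where
  pc : ℕ
  natReg : ℕ → ℕ
  realReg : ℕ → ℝ
  natArr : ℕ → ℕ → ℕ
  realArr : ℕ → ℕ → ℝ

/-- A program is a finite list of instructions, with lines numbered from `0`. -/
abbrev Program : Type := List Instr

/-- The effect of one instruction. -/
def exec (C : Config) : Instr → Config
  | .setN r v => { C with pc := C.pc + 1, natReg := Function.update C.natReg r v }
  | .incN r => { C with pc := C.pc + 1, natReg := Function.update C.natReg r (C.natReg r + 1) }
  | .movN r s => { C with pc := C.pc + 1, natReg := Function.update C.natReg r (C.natReg s) }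
  | .loadN r a s =>
      { C with pc := C.pc + 1, natReg := Function.update C.natReg r (C.natArr a (C.natReg s)) }
  | .storeN a s r =>
      { C with
        pc := C.pc + 1
        natArr := Function.update C.natArr a
          (Function.update (C.natArr a) (C.natReg s) (C.natReg r)) }
  | .loadR r a s =>
      { C with pc := C.pc + 1, realReg := Function.update C.realReg r (C.realArr a (C.natReg s)) }
  | .storeR a s r =>
      { C with
        pc := C.pc + 1
        realArr := Function.update C.realArr a
          (Function.update (C.realArr a) (C.natReg s) (C.realReg r)) }
  | .addR r s t =>
      { C with
        pc := C.pc + 1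
        realReg := Function.update C.realReg r (C.realReg s + C.realReg t) }
  | .subR r s t =>
      { C with
        pc := C.pc + 1
        realReg := Function.update C.realReg r (C.realReg s - C.realReg t) }
  | .mulR r s t =>
      { C with
        pc := C.pc + 1
        realReg := Function.update C.realReg r (C.realReg s * C.realReg t) }
  | .jltN r s l => { C with pc := if C.natReg r < C.natReg s then l else C.pc + 1 }
  | .jmp l => { C with pc := l }

/-- One step. The machine stays put once the program counter has left the program. -/
def step (P : Program) (C : Config) : Config :=
  match P[C.pc]? with
  | some I => exec C I
  | none => C

/-- Started in `C`, the program `P` halts after at most `T` steps in the configuration `C'`. -/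
def HaltsWithin (P : Program) (C : Config) (T : ℝ) (C' : Config) : Prop :=
  ∃ n : ℕ, (n : ℝ) ≤ T ∧ (step P)^[n] C = C' ∧ P.length ≤ C'.pc

/-! ### Sparse storage of matrices and vectors -/

/-- Compressed-column storage: the nonzero entries of column `j` are stored at the positions
`p` with `ptr j ≤ p < ptr (j + 1)`, as a row index `row p` and a value `val p`. -/
structure ColStore : Type where
  ptr : ℕ → ℕ
  row : ℕ → ℕ
  val : ℕ → ℝ

/-- `S` lists exactly the nonzero entries of `M`, column by column, each of them once. -/
def ColStore.Represents {d k : ℕ} (S : ColStore) (M : Matrix (Fin k) (Fin d) ℝ) : Prop :=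
  ∀ j : Fin d,
    S.ptr j ≤ S.ptr (j + 1) ∧
    (∀ p ∈ Set.Ico (S.ptr j) (S.ptr (j + 1)),
      ∃ t : Fin k, S.row p = t ∧ S.val p = M t j ∧ M t j ≠ 0) ∧
    Set.InjOn S.row (Set.Ico (S.ptr j) (S.ptr (j + 1))) ∧
    ∀ t : Fin k, M t j ≠ 0 → ∃ p ∈ Set.Ico (S.ptr j) (S.ptr (j + 1)), S.row p = t

/-- A sparse vector: `len` pairs (index, value), at the positions `0, …, len - 1`. -/
structure VecStore : Type where
  len : ℕ
  idx : ℕ → ℕ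
  val : ℕ → ℝ

/-- `X` lists exactly the nonzero coordinates of `x`, each of them once. -/
def VecStore.Represents {d : ℕ} (X : VecStore) (x : EuclideanSpace ℝ (Fin d)) : Prop :=
  (∀ p < X.len, ∃ j : Fin d, X.idx p = j ∧ X.val p = x j ∧ x j ≠ 0) ∧
  Set.InjOn X.idx (Set.Iio X.len) ∧
  ∀ j : Fin d, x j ≠ 0 → ∃ p < X.len, X.idx p = j

/-- The initial configuration on input `(S, X)`. Everything that does not hold input is zero; in
particular real array `2`, where the output is expected. -/
def initConfig (S : ColStore) (X : VecStore) : Config where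
  pc := 0
  natReg := fun r => if r = 0 then X.len else 0
  realReg := fun _ => 0
  natArr := fun a => if a = 0 then X.idx else if a = 1 then S.ptr else if a = 2 then S.row else 0
  realArr := fun a => if a = 0 then X.val else if a = 1 then S.val else 0

/-- The program `P`, given the stored nonzero entries of `M` and of `x`, in whatever order,
halts after at most `T` steps with `M x` in the first `k` cells of real array `2`. -/
def ComputesProduct {d k : ℕ} (P : Program) (M : Matrix (Fin k) (Fin d) ℝ)
    (x : EuclideanSpace ℝ (Fin d)) (T : ℝ) : Prop :=
  ∀ (S : ColStore) (X : VecStore), S.Represents M → X.Represents x →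
    ∃ C : Config, HaltsWithin P (initConfig S X) T C ∧ ∀ t : Fin k, C.realArr 2 t = apply M x t

end SparseJL

end

/-!
The squared norm of `M x`, for `‖x‖ = 1`, is `1 + ∑ t, Q t`, where
`Q t = ∑ e ≠ f, y e * y f * ξ (t, e) * ξ (t, f)`. Here `e`, `f` range over the `d c` copies of the
coordinates, `y` is `x` with each coordinate duplicated and rescaled (`spread`), and `ξ (t, e)`
(`entry`) is the sign of the copy `e` if it is hashed to the row `t`, and zero otherwise. So a moment
of `∑ t, Q t` of even order `p ≈ L = log (1 / δ)` has to be bounded by `ε ^ p * δ`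
(`one_sub_le_measure_norm_bounds`).

*Independent rows.* Expand the moment into words in the variables `ξ (t, e)`. A word has length `2 p`,
so that `2 p`-wise independence determines its expectation. Compared with the case in which all the
`ξ (t, e)` are independent and nonzero with probability `1 / k`, the expectation is the same, except
that it becomes zero if one copy is asked for in two rows. Only words with even multiplicities
count, and their coefficients are nonnegative; hence the moment is at most the one for independent
variables (`integral_sum_offDiagForm_pow_le`). There the rows are independent and identically
distributed, and with `m q` the moments of one row, the moment of the sum is at most
`p! / s ^ p * exp (k * ∑ q ∈ [2, p], m q * s ^ q / q!)` for each `s > 0`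
(`ternaryExp_sum_rows_pow_le`).

*One row.* The moment `m q` is a sum over Eulerian multigraphs with `q` edges. For a given vertex set
`U` with `v` elements there are at most `v ^ (2 q)` of them, all degrees are at least two, and
`y e ^ 2 ≤ 1 / c`, so that together they contribute at most
`v ^ (2 q) * c ^ (v - q) * k ^ (- v) * ∏ e ∈ U, y e ^ 2`. Summed over all `U`, the last factor gives
at most `∏ e, (1 + y e ^ 2) ≤ exp 1` (`ternaryExp_offDiagForm_pow_le`).

*Numbers.* With `s = 9 p / ε`, the sum in the exponent is at most `L` as soon as `c` is of the order
of `(L / log L) ^ 2 / ε`: by `ε ≤ 1 / L ^ 2` the ratio `c / k` is at most `1 / L`, so each vertex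
costs a factor `exp (- log L)`, which outweighs the number of multigraphs
(`vertex_edge_tradeoff`, `ternaryExp_distortion_pow_le`). This value of `c` does not need the
factor `log log log (1 / δ)` that the sparsity bound allows.

The running time is that of the two nested loops of `mulProgram`, and it holds for every outcome of
the seed.
-/

noncomputable section

namespace SparseJL

open Finset

/-! ### Words and multiplicities -/

section Words

variable {ι A : Type*} [Fintype ι] [DecidableEq A]

/-- The number of occurrences of the letter `a` in the word `u`. -/
def mult (u : ι → A) (a : A) : ℕ := #{i | u i = a}

lemma mult_eq_zero_iff {u : ι → A} {a : A} : mult u a = 0 ↔ a ∉ univ.image u := by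
  simp [mult, Finset.filter_eq_empty_iff]

variable [Fintype A]

lemma sum_mult (u : ι → A) : ∑ a, mult u a = Fintype.card ι := by
  simp only [mult]
  rw [← Finset.card_eq_sum_card_fiberwise (fun _ _ => Finset.mem_coe.2 (mem_univ _))]
  rfl

lemma prod_word {R : Type*} [CommMonoid R] (u : ι → A) (f : A → R) :
    ∏ i, f (u i) = ∏ a, f a ^ mult u a := by
  rw [← Finset.prod_fiberwise univ u]
  refine prod_congr rfl fun a _ => ?_
  rw [mult, ← prod_const]
  exact prod_congr rfl fun i hi => by rw [(mem_filter.1 hi).2]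

lemma prod_word_nonneg {u : ι → A} (hu : ∀ a, Even (mult u a)) (y : A → ℝ) :
    0 ≤ ∏ i, y (u i) := by
  rw [prod_word]
  exact prod_nonneg fun a _ => (hu a).pow_nonneg _

end Words

/-! ### Independent ternary variables -/

/-- The probabilities of a symmetric variable with values in `{-1, 0, 1}` that is nonzero with
probability `θ`. -/
def ternaryWeight (θ : ℝ) (s : SignType) : ℝ := if s = 0 then 1 - θ else θ / 2

lemma sum_ternaryWeight_mul_pow (θ : ℝ) (n : ℕ) :
    ∑ s : SignType, ternaryWeight θ s * (s : ℝ) ^ n =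
      if n = 0 then 1 else if Even n then θ else 0 := by
  have h : (univ : Finset SignType) = {0, -1, 1} := rfl
  rw [h, sum_insert (by decide), sum_insert (by decide), sum_singleton]
  simp only [ternaryWeight]
  rcases eq_or_ne n 0 with rfl | hn
  · norm_num
  · rcases Nat.even_or_odd n with he | ho
    · simp [hn, he]
    · have : ¬ Even n := by simpa using ho
      simp [hn, ho.neg_pow, this]

section Expectation

variable {A : Type*} [Fintype A] [DecidableEq A]

/-- The expectation of `F` over independent symmetric `{-1, 0, 1}`-valued variables indexed by `A`,
each nonzero with probability `θ`, written as a finite weighted sum. -/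
def ternaryExp (θ : ℝ) (F : (A → SignType) → ℝ) : ℝ :=
  ∑ σ : A → SignType, (∏ a, ternaryWeight θ (σ a)) * F σ

lemma ternaryExp_sum {κ : Type*} (θ : ℝ) (s : Finset κ) (F : κ → (A → SignType) → ℝ) :
    ternaryExp θ (fun σ => ∑ i ∈ s, F i σ) = ∑ i ∈ s, ternaryExp θ (F i) := by
  simp only [ternaryExp, mul_sum]
  exact sum_comm

lemma ternaryExp_const_mul (θ b : ℝ) (F : (A → SignType) → ℝ) :
    ternaryExp θ (fun σ => b * F σ) = b * ternaryExp θ F := by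
  simp only [ternaryExp, mul_sum]
  exact sum_congr rfl fun _ _ => by ring

lemma ternaryExp_prod (θ : ℝ) (f : A → SignType → ℝ) :
    ternaryExp θ (fun σ => ∏ a, f a (σ a)) = ∏ a, ∑ s, ternaryWeight θ s * f a s := by
  simp only [ternaryExp, ← prod_mul_distrib]
  rw [prod_univ_sum]
  simp

lemma ternaryExp_word {ι : Type*} [Fintype ι] (θ : ℝ) (u : ι → A) :
    ternaryExp θ (fun σ => ∏ i, (σ (u i) : ℝ)) =
      if ∀ a, Even (mult u a) then θ ^ #(univ.image u) else 0 := by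
  have h : ∀ σ : A → SignType, ∏ i, (σ (u i) : ℝ) = ∏ a, (σ a : ℝ) ^ mult u a :=
    fun σ => prod_word u fun a => (σ a : ℝ)
  simp only [h]
  rw [ternaryExp_prod θ fun a s => (s : ℝ) ^ mult u a]
  simp only [sum_ternaryWeight_mul_pow]
  split_ifs with hu
  · simp only [hu, if_true, mult_eq_zero_iff, ite_not]
    rw [prod_ite_mem, univ_inter, prod_const]
  · push Not at hu
    obtain ⟨a, ha⟩ := hu
    refine prod_eq_zero (mem_univ a) ?_
    have : mult u a ≠ 0 := fun h0 => by simp [h0] at ha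
    simp [this, ha]

/-- Variables in different rows are independent. -/
lemma ternaryExp_prod_rows {T : Type*} [Fintype T] [DecidableEq T] (θ : ℝ)
    (G : T → (A → SignType) → ℝ) :
    ternaryExp θ (fun σ : T × A → SignType => ∏ t, G t fun e => σ (t, e)) =
      ∏ t, ternaryExp θ (G t) := by
  simp only [ternaryExp]
  rw [prod_univ_sum, Fintype.piFinset_univ]
  refine Fintype.sum_equiv (Equiv.curry T A SignType) _ _ fun σ => ?_
  rw [Fintype.prod_prod_type, ← prod_mul_distrib]
  rfl

end Expectation

/-! ### Off-diagonal quadratic forms -/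

/-- The endpoints of a sequence of pairs, as a word of twice the length. The sequence is read as the
edges of a multigraph, in which `mult` counts degrees. -/
def endpoints {ι E : Type*} (w : ι → E × E) (i : ι × Bool) : E :=
  if i.2 then (w i.1).1 else (w i.1).2

lemma prod_endpoints {ι E R : Type*} [Fintype ι] [CommMonoid R] (w : ι → E × E) (f : E → R) :
    ∏ i, f (endpoints w i) = ∏ i, (f (w i).1 * f (w i).2) := by
  simp [Fintype.prod_prod_type, endpoints]

section Chaos

variable {E : Type*} [Fintype E] [DecidableEq E]

/-- The off-diagonal part `∑ e ≠ f, y e y f z e z f` of the square of `∑ e, y e z e`. -/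
def offDiagForm (y z : E → ℝ) : ℝ :=
  ∑ w ∈ (univ : Finset E).offDiag, y w.1 * y w.2 * (z w.1 * z w.2)

lemma offDiagForm_eq (y z : E → ℝ) :
    offDiagForm y z = (∑ e, y e * z e) ^ 2 - ∑ e, y e ^ 2 * z e ^ 2 := by
  have h : ∀ g : E × E → ℝ, ∑ w ∈ (univ : Finset E).offDiag, g w =
      ∑ w, g w - ∑ e, g (e, e) := by
    intro g
    have h1 : ∑ w ∈ (univ : Finset E).diag, g w = ∑ e, g (e, e) := by
      simp [Finset.sum_diag]
    rw [← h1, eq_sub_iff_add_eq, ← sum_union (disjoint_diag_offDiag _).symm,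
      union_comm, diag_union_offDiag, univ_product_univ]
  rw [offDiagForm, h, sq, sum_mul_sum, Fintype.sum_prod_type]
  congr 1
  · exact sum_congr rfl fun _ _ => sum_congr rfl fun _ _ => by ring
  · exact sum_congr rfl fun _ _ => by ring

/-- Expansion of a moment over Eulerian multigraphs. -/
lemma ternaryExp_offDiagForm_pow (θ : ℝ) (y : E → ℝ) (q : ℕ) :
    ternaryExp θ (fun σ => offDiagForm y (fun e => (σ e : ℝ)) ^ q) =
      ∑ w ∈ Fintype.piFinset fun _ : Fin q => (univ : Finset E).offDiag,
        (∏ i, y (endpoints w i)) *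
          if ∀ e, Even (mult (endpoints w) e) then θ ^ #(univ.image (endpoints w)) else 0 := by
  simp only [offDiagForm, sum_pow']
  rw [ternaryExp_sum]
  refine sum_congr rfl fun w _ => ?_
  rw [← ternaryExp_word, ← ternaryExp_const_mul]
  congr 1
  funext σ
  rw [prod_mul_distrib, prod_endpoints, prod_endpoints w (fun e => (σ e : ℝ))]

lemma ternaryExp_offDiagForm_pow_nonneg {θ : ℝ} (hθ : 0 ≤ θ) (y : E → ℝ) (q : ℕ) :
    0 ≤ ternaryExp θ (fun σ => offDiagForm y (fun e => (σ e : ℝ)) ^ q) := by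
  rw [ternaryExp_offDiagForm_pow]
  refine sum_nonneg fun w _ => ?_
  split_ifs with h
  · exact mul_nonneg (prod_word_nonneg h y) (by positivity)
  · simp

/-- In an Eulerian multigraph with `q` edges all degrees are at least two, so that the
weights `y e ^ 2 ≤ κ` may be used to bound all but two of the factors at each vertex. -/
lemma prod_endpoints_le {κ : ℝ} {y : E → ℝ} (hκ : ∀ e, y e ^ 2 ≤ κ) {q : ℕ}
    {w : Fin q → E × E} (he : ∀ e, Even (mult (endpoints w) e)) :
    #(univ.image (endpoints w)) ≤ q ∧
      ∏ i, y (endpoints w i) ≤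
        κ ^ (q - #(univ.image (endpoints w))) * ∏ e ∈ univ.image (endpoints w), y e ^ 2 := by
  classical
  set U := univ.image (endpoints w) with hU
  choose m hm using he
  have hm0 : ∀ e ∈ U, 1 ≤ m e := by
    intro e heU
    by_contra h
    have h0 : mult (endpoints w) e = 0 := by have := hm e; omega
    exact (mult_eq_zero_iff.1 h0) heU
  have hm1 : ∀ e ∉ U, m e = 0 := by
    intro e heU
    have := mult_eq_zero_iff.2 heU
    have := hm e
    omega
  have hsum : ∑ e ∈ U, m e = q := by
    have h1 : ∑ e, mult (endpoints w) e = q * 2 := by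
      rw [sum_mult]; simp
    have h2 : ∑ e ∈ U, m e = ∑ e, m e :=
      sum_subset (subset_univ _) fun e _ h => hm1 e h
    have h3 : ∑ e, mult (endpoints w) e = (∑ e, m e) * 2 := by
      rw [sum_mul]; exact sum_congr rfl fun e _ => by rw [hm e]; ring
    omega
  have hsum' : ∑ e ∈ U, (m e - 1) + #U = q := by
    rw [← hsum, card_eq_sum_ones, ← sum_add_distrib]
    exact sum_congr rfl fun e h => Nat.sub_add_cancel (hm0 e h)
  refine ⟨by omega, ?_⟩
  have h4 : ∏ i, y (endpoints w i) = ∏ e ∈ U, (y e ^ 2) ^ m e := by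
    rw [prod_word]
    symm
    rw [prod_subset (subset_univ U) fun e _ h => by rw [hm1 e h, pow_zero]]
    exact prod_congr rfl fun e _ => by rw [hm e, ← pow_mul, two_mul]
  have h5 : q - #U = ∑ e ∈ U, (m e - 1) := by omega
  rw [h4, h5, ← prod_pow_eq_pow_sum, ← prod_mul_distrib]
  refine prod_le_prod (fun e _ => by positivity) fun e h => ?_
  conv_lhs => rw [← Nat.sub_add_cancel (hm0 e h), pow_succ]
  gcongr
  exact hκ e

/-- Moments of the form in one row. Grouping the multigraphs by their vertex set `U`, there are at
most `#U ^ (2 q)` of them, and the sum over `U` of `∏ e ∈ U, y e ^ 2` is at most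
`∏ e, (1 + y e ^ 2)`. -/
lemma ternaryExp_offDiagForm_pow_le {θ κ B : ℝ} (hθ : 0 ≤ θ) (hB : 0 ≤ B) {y : E → ℝ}
    (hy : ∑ e, y e ^ 2 = 1) (hκ : ∀ e, y e ^ 2 ≤ κ) {q : ℕ} (hq : 1 ≤ q)
    (h : ∀ v : ℕ, 2 ≤ v → v ≤ q → (v : ℝ) ^ (2 * q) * (κ ^ (q - v) * θ ^ v) ≤ B) :
    ternaryExp θ (fun σ => offDiagForm y (fun e => (σ e : ℝ)) ^ q) ≤ Real.exp 1 * B := by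
  classical
  have hκ0 : 0 ≤ κ := by
    rcases isEmpty_or_nonempty E with hE | ⟨⟨e⟩⟩
    · simp at hy
    · exact (sq_nonneg _).trans (hκ e)
  let F : Finset E → ℝ := fun U =>
    if 2 ≤ #U ∧ #U ≤ q then κ ^ (q - #U) * θ ^ #U * ∏ e ∈ U, y e ^ 2 else 0
  have hF0 : ∀ U, 0 ≤ F U := fun U => by
    simp only [F]
    split_ifs
    · have : 0 ≤ ∏ e ∈ U, y e ^ 2 := prod_nonneg fun e _ => sq_nonneg _
      positivity
    · exact le_rfl
  rw [ternaryExp_offDiagForm_pow]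
  set W := Fintype.piFinset fun _ : Fin q => (univ : Finset E).offDiag with hW
  have h1 : ∀ w ∈ W, (∏ i, y (endpoints w i)) *
      (if ∀ e, Even (mult (endpoints w) e) then θ ^ #(univ.image (endpoints w)) else 0) ≤
      F (univ.image (endpoints w)) := by
    intro w hw
    split_ifs with he
    · obtain ⟨hc, hle⟩ := prod_endpoints_le hκ he
      have h2 : 2 ≤ #(univ.image (endpoints w)) := by
        have hd := (Fintype.mem_piFinset.1 hw) ⟨0, hq⟩
        rw [mem_offDiag] at hd
        refine Finset.one_lt_card.2 ⟨_, mem_image_of_mem _ (mem_univ (⟨0, hq⟩, true)),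
          _, mem_image_of_mem _ (mem_univ (⟨0, hq⟩, false)), ?_⟩
        simpa [endpoints] using hd.2.2
      simp only [F, if_pos (And.intro h2 hc)]
      calc _ ≤ (κ ^ (q - #(univ.image (endpoints w))) *
              ∏ e ∈ univ.image (endpoints w), y e ^ 2) * θ ^ #(univ.image (endpoints w)) := by
            gcongr
        _ = _ := by ring
    · rw [mul_zero]; exact hF0 _
  have h2 : ∀ U : Finset E, #{w ∈ W | univ.image (endpoints w) = U} ≤ #U ^ (2 * q) := by
    intro U
    calc _ ≤ #(Fintype.piFinset fun _ : Fin q => U ×ˢ U) := by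
          refine card_le_card fun w hw => ?_
          rw [mem_filter] at hw
          rw [Fintype.mem_piFinset]
          intro i
          rw [mem_product, ← hw.2]
          exact ⟨mem_image.2 ⟨(i, true), mem_univ _, by simp [endpoints]⟩,
            mem_image.2 ⟨(i, false), mem_univ _, by simp [endpoints]⟩⟩
      _ = _ := by
          rw [Fintype.card_piFinset_const, card_product, ← sq, ← pow_mul]
  calc _ ≤ ∑ w ∈ W, F (univ.image (endpoints w)) := sum_le_sum h1
    _ = ∑ U : Finset E, ∑ w ∈ W with univ.image (endpoints w) = U,
          F (univ.image (endpoints w)) := (sum_fiberwise _ _ _).symm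
    _ = ∑ U : Finset E, #{w ∈ W | univ.image (endpoints w) = U} * F U := by
        refine sum_congr rfl fun U _ => ?_
        rw [sum_congr rfl fun w hw => by rw [(mem_filter.1 hw).2], sum_const, nsmul_eq_mul]
    _ ≤ ∑ U : Finset E, B * ∏ e ∈ U, y e ^ 2 := by
        refine sum_le_sum fun U _ => ?_
        have hp : 0 ≤ ∏ e ∈ U, y e ^ 2 := prod_nonneg fun e _ => sq_nonneg _
        by_cases hU : 2 ≤ #U ∧ #U ≤ q
        · calc _ ≤ ((#U : ℝ) ^ (2 * q)) * F U := by
                refine mul_le_mul_of_nonneg_right ?_ (hF0 U)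
                exact_mod_cast h2 U
            _ = (#U : ℝ) ^ (2 * q) * (κ ^ (q - #U) * θ ^ #U) * ∏ e ∈ U, y e ^ 2 := by
                simp only [F, if_pos hU]; ring
            _ ≤ _ := by
                gcongr
                exact h _ hU.1 hU.2
        · simp only [F, if_neg hU, mul_zero]
          positivity
    _ = B * ∏ e, (1 + y e ^ 2) := by
        rw [← mul_sum, prod_one_add, powerset_univ]
    _ ≤ B * Real.exp (∑ e, y e ^ 2) := by
        gcongr
        exact Real.prod_one_add_le_exp_sum _ fun e => sq_nonneg _
    _ = _ := by rw [hy, mul_comm]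

/-! ### Sums of independent rows -/

/-- A moment of a sum of independent, identically distributed rows with nonnegative moments and
mean at most zero, by way of the exponential generating function of the moments of one row. -/
lemma ternaryExp_sum_rows_pow_le {T : Type*} [Fintype T] [DecidableEq T] {θ s : ℝ} (hs : 0 < s)
    (Q : (E → SignType) → ℝ) (h0 : ∀ q, 0 ≤ ternaryExp θ (fun σ => Q σ ^ q))
    (h1 : ternaryExp θ (fun σ => Q σ ^ 1) ≤ 0) (p : ℕ) :
    ternaryExp θ (fun σ : T × E → SignType => (∑ t, Q fun e => σ (t, e)) ^ p) ≤
      p.factorial * s⁻¹ ^ p * Real.exp (Fintype.card T *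
        ∑ q ∈ Icc 2 p, ternaryExp θ (fun σ => Q σ ^ q) * s ^ q / q.factorial) := by
  classical
  set m : ℕ → ℝ := fun q => ternaryExp θ (fun σ => Q σ ^ q) with hm
  set S := ∑ q ∈ Icc 2 p, m q * s ^ q / q.factorial with hS
  have hm0 : m 0 = 1 := by
    have := ternaryExp_prod (A := E) θ fun _ _ => (1 : ℝ)
    have h2 := sum_ternaryWeight_mul_pow θ 0
    simp only [pow_zero, if_true, mul_one] at h2
    simpa [hm, h2] using this
  have hS0 : 0 ≤ S := sum_nonneg fun q _ => by have := h0 q; simp only [hm]; positivity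
  have hrow : ∑ q ∈ range (p + 1), m q * s ^ q / q.factorial ≤ 1 + S := by
    rcases p with _ | p
    · simpa [hm0] using hS0
    · rw [range_eq_Ico, sum_eq_sum_Ico_succ_bot (by omega), sum_eq_sum_Ico_succ_bot (by omega)]
      have h3 : Ico (0 + 1 + 1) (p + 1 + 1) = Icc 2 (p + 1) := by ext; simp
      rw [h3, ← hS, hm0]
      have : m (0 + 1) ≤ 0 := h1
      have := mul_nonpos_of_nonpos_of_nonneg this hs.le
      simp at this ⊢
      linarith
  have hexp : ternaryExp θ (fun σ : T × E → SignType => (∑ t, Q fun e => σ (t, e)) ^ p) =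
      p.factorial * s⁻¹ ^ p * ∑ n ∈ piAntidiag (univ : Finset T) p,
        ∏ t, m (n t) * s ^ n t / (n t).factorial := by
    simp only [sum_pow_eq_sum_piAntidiag]
    rw [ternaryExp_sum, mul_sum]
    refine sum_congr rfl fun n hn => ?_
    rw [ternaryExp_const_mul, ternaryExp_prod_rows θ fun t σ => Q σ ^ n t]
    have hn' : ∑ t, n t = p := by simpa using hn
    have hfac := Nat.multinomial_spec univ n
    rw [hn'] at hfac
    have hfac' : (p.factorial : ℝ) = (∏ t, ((n t).factorial : ℝ)) * Nat.multinomial univ n := by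
      rw [← hfac]; push_cast; rfl
    have hne : (∏ t, ((n t).factorial : ℝ)) ≠ 0 :=
      prod_ne_zero_iff.2 fun t _ => by positivity
    rw [prod_div_distrib, prod_mul_distrib, prod_pow_eq_pow_sum, hn', hfac']
    rw [inv_pow]
    field_simp
    simp only [hm]
  have hsub : piAntidiag (univ : Finset T) p ⊆ Fintype.piFinset fun _ => range (p + 1) := by
    intro n hn
    have hn' : ∑ t, n t = p := by simpa using hn
    rw [Fintype.mem_piFinset]
    intro t
    have := single_le_sum (f := n) (fun _ _ => Nat.zero_le _) (mem_univ t)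
    rw [mem_range]; omega
  rw [hexp]
  gcongr
  have hpos : ∀ q, 0 ≤ m q * s ^ q / q.factorial := fun q => by
    have := h0 q; simp only [hm]; positivity
  calc _ ≤ ∑ n ∈ Fintype.piFinset fun _ : T => range (p + 1),
        ∏ t, m (n t) * s ^ n t / (n t).factorial :=
        sum_le_sum_of_subset_of_nonneg hsub fun n _ _ => prod_nonneg fun t _ => hpos _
    _ = ∏ _t : T, ∑ q ∈ range (p + 1), m q * s ^ q / q.factorial := by
        rw [prod_univ_sum]
    _ ≤ ∏ _t : T, Real.exp S := by
        refine prod_le_prod (fun t _ => sum_nonneg fun q _ => hpos q) fun t _ => ?_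
        exact hrow.trans (by linarith [Real.add_one_le_exp S])
    _ = _ := by rw [prod_const, card_univ, ← Real.exp_nat_mul]

end Chaos

/-! ### Moments under a limited-independence seed -/

lemma WiseIndep.integral_prod {Ω ι β : Type*} [MeasurableSpace Ω] [MeasurableSpace β]
    {r : ℕ} {X : ι → Ω → β} {μ : Measure Ω} (h : WiseIndep r X μ) (hX : ∀ i, Measurable (X i))
    {S : Finset ι} (hS : #S ≤ r) {f : ι → β → ℝ} (hf : ∀ i, Measurable (f i)) :
    ∫ ω, ∏ i ∈ S, f i (X i ω) ∂μ = ∏ i ∈ S, ∫ ω, f i (X i ω) ∂μ := by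
  have := (h S hS).integral_fun_prod_comp (f := fun i : S => f i)
    (fun i => (hX i).aemeasurable) fun i => (hf i).aestronglyMeasurable
  rw [← prod_coe_sort S fun i => ∫ ω, f i (X i ω) ∂μ, ← this]
  congr 1
  funext ω
  exact (prod_coe_sort S fun i => f i (X i ω)).symm

section

variable {d k c : ℕ}

/-- The signed indicator of the event that the copy `a.2` is hashed to the row `a.1`. -/
def entry (ω : Seed d k c) (a : Fin k × (Fin d × Fin c)) : ℝ :=
  if ω.1 a.2 = a.1 then sgn (ω.2 a.2) else 0

lemma sgn_mul_self (b : Bool) : sgn b * sgn b = 1 := by cases b <;> simp [sgn]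

lemma integral_hash {r : ℕ} {ν : Measure (Seed d k c)} (hν : IsSeedLaw r ν)
    (e : Fin d × Fin c) (t : Fin k) :
    ∫ ω, (if ω.1 e = t then (1 : ℝ) else 0) ∂ν = (k : ℝ)⁻¹ := by
  have h : (fun ω : Seed d k c => if ω.1 e = t then (1 : ℝ) else 0) =
      Set.indicator {ω | ω.1 e = t} 1 := by
    funext ω; simp [Set.indicator_apply]
  rw [h, integral_indicator_one (Set.toFinite _).measurableSet, Measure.real,
    hν.hash_uniform e t]
  simp

lemma integral_sgn_pow {r : ℕ} {ν : Measure (Seed d k c)} (hν : IsSeedLaw r ν)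
    (e : Fin d × Fin c) (n : ℕ) :
    ∫ ω, sgn (ω.2 e) ^ n ∂ν = if Even n then 1 else 0 := by
  have := hν.prob
  split_ifs with hn
  · have h : ∀ b, sgn b ^ n = 1 := fun b => by
      obtain ⟨m, rfl⟩ := hn
      rw [← two_mul, pow_mul, sq, sgn_mul_self, one_pow]
    simp [h]
  · have h : ∀ ω : Seed d k c, sgn (ω.2 e) ^ n =
        Set.indicator {ω : Seed d k c | ω.2 e = true} 1 ω -
          Set.indicator {ω : Seed d k c | ω.2 e = false} 1 ω := fun ω => by
      have ho : Odd n := by simpa using hn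
      cases hb : ω.2 e <;> simp [sgn, hb, ho.neg_pow]
    have hm : ∀ b, MeasurableSet {ω : Seed d k c | ω.2 e = b} :=
      fun b => (Set.toFinite _).measurableSet
    simp only [h]
    rw [integral_sub Integrable.of_finite Integrable.of_finite, integral_indicator_one (hm _),
      integral_indicator_one (hm _), Measure.real, Measure.real, hν.sign_uniform,
      hν.sign_uniform, sub_self]

lemma prod_entry {ι : Type*} [Fintype ι] {u : ι → Fin k × (Fin d × Fin c)}
    (τ : Fin d × Fin c → Fin k) (hτ : ∀ i, (u i).1 = τ (u i).2) (ω : Seed d k c) :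
    ∏ i, entry ω (u i) =
      (∏ e ∈ univ.image (fun i => (u i).2), if ω.1 e = τ e then (1 : ℝ) else 0) *
        ∏ e ∈ univ.image (fun i => (u i).2), sgn (ω.2 e) ^ mult (fun i => (u i).2) e := by
  have h1 : ∀ i, entry ω (u i) =
      (if ω.1 (u i).2 = τ (u i).2 then (1 : ℝ) else 0) * sgn (ω.2 (u i).2) := fun i => by
    simp only [entry, hτ i]; split_ifs <;> simp
  have h2 : ∏ i, sgn (ω.2 (u i).2) =
      ∏ e ∈ univ.image (fun i => (u i).2), sgn (ω.2 e) ^ mult (fun i => (u i).2) e :=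
    prod_comp (fun e => sgn (ω.2 e)) fun i => (u i).2
  rw [prod_congr rfl fun i _ => h1 i, prod_mul_distrib, h2]
  congr 1
  rw [prod_ite_zero, prod_ite_zero]
  simp

lemma integral_hash_mul_sgn {r : ℕ} {ν : Measure (Seed d k c)} (hν : IsSeedLaw r ν)
    {S : Finset (Fin d × Fin c)} (hS : #S ≤ r) (τ : Fin d × Fin c → Fin k)
    (n : Fin d × Fin c → ℕ) :
    ∫ ω, (∏ e ∈ S, if ω.1 e = τ e then (1 : ℝ) else 0) * ∏ e ∈ S, sgn (ω.2 e) ^ n e ∂ν =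
      (k : ℝ)⁻¹ ^ #S * if ∀ e ∈ S, Even (n e) then 1 else 0 := by
  have hind := hν.indep.comp (φ := fun h => ∏ e ∈ S, if h e = τ e then (1 : ℝ) else 0)
      (ψ := fun s => ∏ e ∈ S, sgn (s e) ^ n e)
      (measurable_of_countable _) (measurable_of_countable _)
  have h1 := hν.hash_wise.integral_prod (fun e => measurable_of_countable _) hS
      (f := fun e t => if t = τ e then (1 : ℝ) else 0) (fun _ => measurable_of_countable _)
  have h2 := hν.sign_wise.integral_prod (fun e => measurable_of_countable _) hS
      (f := fun e b => sgn b ^ n e) (fun _ => measurable_of_countable _)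
  have h3 := hind.integral_mul_eq_mul_integral (measurable_of_countable _).aestronglyMeasurable
      (measurable_of_countable _).aestronglyMeasurable
  refine h3.trans ?_
  refine (congrArg₂ (· * ·) h1 h2).trans ?_
  simp only [integral_hash hν, integral_sgn_pow hν, prod_const]
  rw [prod_ite_zero, prod_const_one]
  congr

/-- If every copy that occurs in a word is asked for in one row only, then the word has the same
expectation as for independent ternary variables. -/
lemma integral_prod_entry {r : ℕ} {ν : Measure (Seed d k c)} (hν : IsSeedLaw r ν)
    {ι : Type*} [Fintype ι] (hr : Fintype.card ι ≤ r) {u : ι → Fin k × (Fin d × Fin c)}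
    (τ : Fin d × Fin c → Fin k) (hτ : ∀ i, (u i).1 = τ (u i).2) :
    ∫ ω, ∏ i, entry ω (u i) ∂ν =
      ternaryExp (k : ℝ)⁻¹ fun σ => ∏ i, (σ (u i) : ℝ) := by
  obtain ⟨v, hv⟩ : ∃ v : ι → Fin d × Fin c, v = fun i => (u i).2 := ⟨_, rfl⟩
  have hu : u = fun i => (τ (v i), v i) :=
    funext fun i => Prod.ext (by rw [hv]; exact hτ i) (by rw [hv])
  have hS : #(univ.image v) ≤ r := (card_image_le.trans (by simp)).trans hr
  have hcard : #(univ.image u) = #(univ.image v) := by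
    have : univ.image u = (univ.image v).image fun e => (τ e, e) := by
      rw [image_image, hu]; rfl
    rw [this, card_image_of_injective _ fun a b h => congrArg Prod.snd h]
  have hmult : (∀ a, Even (mult u a)) ↔ ∀ e, Even (mult v e) := by
    have h1 : ∀ e, mult u (τ e, e) = mult v e := fun e => by
      rw [mult, mult, hu]
      congr 1
      ext i
      simp only [mem_filter, mem_univ, true_and, Prod.mk.injEq]
      exact ⟨fun h => h.2, fun h => ⟨by rw [h], h⟩⟩
    refine ⟨fun h e => h1 e ▸ h _, fun h a => ?_⟩
    by_cases ha : a.1 = τ a.2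
    · have : a = (τ a.2, a.2) := Prod.ext ha rfl
      rw [this, h1]
      exact h _
    · have : mult u a = 0 := by
        rw [mult_eq_zero_iff, hu]
        intro hmem
        obtain ⟨i, -, rfl⟩ := mem_image.1 hmem
        exact ha rfl
      simp [this]
  have hev : (∀ e ∈ univ.image v, Even (mult v e)) ↔ ∀ e, Even (mult v e) := by
    refine ⟨fun h e => ?_, fun h e _ => h e⟩
    by_cases he : e ∈ univ.image v
    · exact h e he
    · simp [mult_eq_zero_iff.2 he]
  have h4 : ∫ ω, ∏ i, entry ω (u i) ∂ν = _ :=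
    (congrArg (fun F => ∫ ω, F ω ∂ν) (funext fun ω => prod_entry τ hτ ω)).trans
      (integral_hash_mul_sgn hν (by rw [hv] at hS; exact hS) τ _)
  rw [h4, ternaryExp_word, ← hv]
  simp only [hmult, hcard, hev, mul_ite, mul_one, mul_zero]

/-- Each weighted word has at most the expectation that it has for independent ternary variables:
words that ask for one copy in two different rows vanish under the seed. -/
lemma weighted_integral_prod_entry_le {r : ℕ} {ν : Measure (Seed d k c)} (hν : IsSeedLaw r ν)
    {ι : Type*} [Fintype ι] (hr : Fintype.card ι ≤ r) (u : ι → Fin k × (Fin d × Fin c))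
    (y : Fin d × Fin c → ℝ) :
    (∏ i, y (u i).2) * ∫ ω, ∏ i, entry ω (u i) ∂ν ≤
      (∏ i, y (u i).2) * ternaryExp (k : ℝ)⁻¹ fun σ => ∏ i, (σ (u i) : ℝ) := by
  classical
  by_cases hc : ∀ i j, (u i).2 = (u j).2 → (u i).1 = (u j).1
  · rcases isEmpty_or_nonempty ι with hι | ⟨⟨i₀⟩⟩
    · have := hν.prob
      have h := ternaryExp_word (k : ℝ)⁻¹ u
      simp only [univ_eq_empty, prod_empty, image_empty, card_empty, pow_zero, mult,
        filter_empty, Even.zero, implies_true, if_true] at h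
      simp [h]
    · let τ : Fin d × Fin c → Fin k := fun e =>
        if h : ∃ i, (u i).2 = e then (u h.choose).1 else (u i₀).1
      have hτ : ∀ i, (u i).1 = τ (u i).2 := fun i => by
        have h : ∃ j, (u j).2 = (u i).2 := ⟨i, rfl⟩
        simp only [τ, dif_pos h]
        exact hc _ _ h.choose_spec.symm
      rw [integral_prod_entry hν hr τ hτ]
  · push Not at hc
    obtain ⟨i, j, hij, hne⟩ := hc
    have h0 : ∀ ω : Seed d k c, ∏ i, entry ω (u i) = 0 := fun ω => by
      by_cases hi : ω.1 (u i).2 = (u i).1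
      · refine prod_eq_zero (mem_univ j) ?_
        rw [entry, if_neg]
        rw [← hij, hi]
        exact hne
      · exact prod_eq_zero (mem_univ i) (by rw [entry, if_neg hi])
    simp only [h0, integral_zero, mul_zero]
    rw [ternaryExp_word]
    split_ifs with he
    · exact mul_nonneg (prod_word_nonneg he fun a => y a.2) (by positivity)
    · simp

lemma entry_eq (ω : Seed d k c) (t : Fin k) (e : Fin d × Fin c) :
    entry ω (t, e) = if ω.1 e = t then sgn (ω.2 e) else 0 := rfl

/-- The expansion of a power of a sum of off-diagonal forms over the rows. -/
lemma sum_offDiagForm_pow {T E : Type*} [Fintype T] [DecidableEq T] [Fintype E] [DecidableEq E]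
    (y : E → ℝ) (z : T × E → ℝ) (p : ℕ) :
    (∑ t, offDiagForm y fun e => z (t, e)) ^ p =
      ∑ w ∈ Fintype.piFinset fun _ : Fin p => (univ : Finset T) ×ˢ (univ : Finset E).offDiag,
        (∏ i : Fin p × Bool, y (endpoints (fun j => (w j).2) i)) *
          ∏ i : Fin p × Bool, z ((w i.1).1, endpoints (fun j => (w j).2) i) := by
  simp only [offDiagForm]
  rw [← sum_product' (univ : Finset T) (univ : Finset E).offDiag
    fun t w => y w.1 * y w.2 * (z (t, w.1) * z (t, w.2)), sum_pow']
  refine sum_congr rfl fun w _ => ?_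
  rw [prod_mul_distrib, prod_endpoints, Fintype.prod_prod_type]
  simp [endpoints]

lemma integral_sum_offDiagForm_pow_le {r : ℕ} {ν : Measure (Seed d k c)} (hν : IsSeedLaw r ν)
    {p : ℕ} (hr : 2 * p ≤ r) (y : Fin d × Fin c → ℝ) :
    ∫ ω, (∑ t, offDiagForm y fun e => entry ω (t, e)) ^ p ∂ν ≤
      ternaryExp (k : ℝ)⁻¹ fun σ : Fin k × (Fin d × Fin c) → SignType =>
        (∑ t, offDiagForm y fun e => (σ (t, e) : ℝ)) ^ p := by
  have := hν.prob
  simp only [sum_offDiagForm_pow y (entry _)]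
  have h := fun σ : Fin k × (Fin d × Fin c) → SignType =>
    sum_offDiagForm_pow y (fun a => (σ a : ℝ)) p
  simp only [h]
  rw [ternaryExp_sum, integral_finsetSum _ fun w _ => Integrable.of_finite]
  refine sum_le_sum fun w _ => ?_
  rw [integral_const_mul, ternaryExp_const_mul]
  exact weighted_integral_prod_entry_le hν (by simpa [mul_comm] using hr)
    (fun i => ((w i.1).1, endpoints (fun j => (w j).2) i)) y

end

/-! ### Numerical estimates -/

lemma sq_le_two_mul_exp {x : ℝ} (hx : 0 ≤ x) : x ^ 2 ≤ 2 * Real.exp x := by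
  linarith [Real.quadratic_le_exp_of_nonneg hx]

/-- The entropy estimate that dictates the number of nonzero entries. A multigraph with `a + 2`
edges has `(b + 2) ^ (2 (a + 2))` chances, and each of its vertices but two costs a factor
`1 / L = exp (- log L)`. The trade-off between the two is `x ^ 2 ≤ 2 exp x` at `x = b log L / a`. -/
lemma vertex_edge_tradeoff {L η u lam : ℝ} (hη : 0 ≤ η) (hL : 0 < L) (hlog : 1 ≤ Real.log L)
    (hu0 : 0 ≤ u) (hu : u ≤ η * Real.log L ^ 2 / L) (hlam0 : 0 ≤ lam) (hlam : lam ≤ 1 / L)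
    {a b : ℕ} (hba : b ≤ a) (ha : (a : ℝ) + 2 ≤ 2 * L) :
    (((b : ℝ) + 2) ^ 2 / (a + 2) * u) ^ a * lam ^ b ≤ (36 * η) ^ a := by
  set l := Real.log L with hl
  have hexp : Real.exp l = L := Real.exp_log hL
  rcases Nat.eq_zero_or_pos b with rfl | hb
  · rw [pow_zero, mul_one]
    refine pow_le_pow_left₀ (by positivity) ?_ a
    have h1 : l ^ 2 ≤ 2 * L := by rw [← hexp]; exact sq_le_two_mul_exp (by linarith)
    have h2 : u ≤ 2 * η := hu.trans (by
      rw [div_le_iff₀ hL]; nlinarith)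
    have h3 : (((0 : ℕ) : ℝ) + 2) ^ 2 / (a + 2) ≤ 2 := by
      rw [div_le_iff₀ (by positivity)]
      have : (0 : ℝ) ≤ a := by positivity
      norm_num; linarith
    calc _ ≤ 2 * (2 * η) := by gcongr
      _ ≤ _ := by linarith
  · have hapos : (0 : ℝ) < a := by exact_mod_cast (lt_of_lt_of_le hb hba)
    have hb1 : (1 : ℝ) ≤ b := by exact_mod_cast hb
    set x := b * l / a with hx
    have hx0 : 0 ≤ x := by positivity
    have h1 : ((b : ℝ) + 2) ^ 2 / (a + 2) * u ≤ 36 * η * Real.exp x := by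
      have h2 : ((b : ℝ) + 2) * l / (a + 2) ≤ 3 * x := by
        rw [hx, div_le_iff₀ (by positivity)]
        have h5 : (b : ℝ) * l * 3 ≤ 3 * (b * l / a) * (a + 2) := by
          have : 3 * (b * l / a) * a = (b : ℝ) * l * 3 := by field_simp
          have h6 : 0 ≤ (b : ℝ) * l / a := by positivity
          nlinarith
        nlinarith
      have h3 : 1 / L ≤ 2 / ((a : ℝ) + 2) := by
        rw [div_le_div_iff₀ hL (by positivity)]; linarith
      calc ((b : ℝ) + 2) ^ 2 / (a + 2) * u
          ≤ ((b : ℝ) + 2) ^ 2 / (a + 2) * (η * l ^ 2 / L) := by gcongr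
        _ = ((b : ℝ) + 2) ^ 2 / (a + 2) * (η * l ^ 2) * (1 / L) := by ring
        _ ≤ ((b : ℝ) + 2) ^ 2 / (a + 2) * (η * l ^ 2) * (2 / ((a : ℝ) + 2)) := by gcongr
        _ = 2 * η * (((b : ℝ) + 2) * l / (a + 2)) ^ 2 := by field_simp
        _ ≤ 2 * η * (3 * x) ^ 2 := by gcongr
        _ = 18 * η * x ^ 2 := by ring
        _ ≤ 18 * η * (2 * Real.exp x) := by gcongr; exact sq_le_two_mul_exp hx0
        _ = _ := by ring
    have h4 : Real.exp x ^ a = L ^ b := by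
      rw [← Real.exp_nat_mul, ← hexp, ← Real.exp_nat_mul, hx]
      congr 1
      field_simp
    calc _ ≤ (36 * η * Real.exp x) ^ a * (1 / L) ^ b := by gcongr
      _ = (36 * η) ^ a * (L ^ b * (1 / L) ^ b) := by rw [mul_pow, h4]; ring
      _ = _ := by rw [← mul_pow, mul_one_div_cancel hL.ne', one_pow, mul_one]

/-- The factor `v ^ (2 q)` is absorbed by `q!` up to the quantity of `vertex_edge_tradeoff`. -/
lemma pow_div_factorial_le {a b : ℕ} (hba : b ≤ a) :
    ((b : ℝ) + 2) ^ (2 * (a + 2)) / (a + 2).factorial ≤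
      4 * Real.exp 1 ^ 2 * (4 * Real.exp 1 * (((b : ℝ) + 2) ^ 2 / (a + 2))) ^ a := by
  set q : ℝ := (a : ℝ) + 2 with hq
  have hq0 : 0 < q := by positivity
  have h1 : q ^ (a + 2) / (a + 2).factorial ≤ Real.exp 1 ^ (a + 2) := by
    have := Real.pow_div_factorial_le_exp q hq0.le (a + 2)
    rwa [show Real.exp q = Real.exp 1 ^ (a + 2) by
      rw [← Real.exp_nat_mul, hq]; push_cast; ring_nf] at this
  have hv : (b : ℝ) + 2 ≤ q := by rw [hq]; gcongr
  have h2 : (((b : ℝ) + 2) ^ 2 / q) ^ 2 ≤ 4 * 4 ^ a := by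
    have h3 : ((b : ℝ) + 2) ^ 2 / q ≤ q := by
      rw [div_le_iff₀ hq0, ← sq]; gcongr
    have h4 : q ≤ 2 * 2 ^ a := by
      have : (a + 1 : ℝ) ≤ 2 ^ a := by exact_mod_cast Nat.lt_two_pow_self
      have : (1 : ℝ) ≤ 2 ^ a := one_le_pow₀ (by norm_num)
      linarith
    calc _ ≤ (2 * 2 ^ a : ℝ) ^ 2 := by gcongr; exact h3.trans h4
      _ = _ := by rw [mul_pow, ← pow_mul, mul_comm a 2, pow_mul]; norm_num
  calc ((b : ℝ) + 2) ^ (2 * (a + 2)) / (a + 2).factorial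
      = (((b : ℝ) + 2) ^ 2 / q) ^ (a + 2) * (q ^ (a + 2) / (a + 2).factorial) := by
        rw [pow_mul, div_pow]; field_simp
    _ ≤ (((b : ℝ) + 2) ^ 2 / q) ^ (a + 2) * Real.exp 1 ^ (a + 2) := by gcongr
    _ = (((b : ℝ) + 2) ^ 2 / q) ^ 2 * (Real.exp 1 ^ 2 *
          (Real.exp 1 * (((b : ℝ) + 2) ^ 2 / q)) ^ a) := by rw [mul_pow]; ring
    _ ≤ 4 * 4 ^ a * (Real.exp 1 ^ 2 * (Real.exp 1 * (((b : ℝ) + 2) ^ 2 / q)) ^ a) := by gcongr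
    _ = _ := by simp only [mul_pow]; ring

/-- The contribution of the multigraphs with `q` edges and `v` vertices in one row. -/
lemma edge_vertex_term_le {L s k c : ℝ} (hL : 0 < L) (hlog : 1 ≤ Real.log L) (hs : 0 < s)
    (hk : 0 < k) (hc : 0 < c) (hu : s / c ≤ 1 / 864 * Real.log L ^ 2 / L) (hlam : c / k ≤ 1 / L)
    {q v : ℕ} (hv : 2 ≤ v) (hvq : v ≤ q) (hq : (q : ℝ) ≤ 2 * L) :
    (v : ℝ) ^ (2 * q) * (c⁻¹ ^ (q - v) * k⁻¹ ^ v) ≤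
      4 * Real.exp 1 ^ 2 * (s ^ 2 / k) * (1 / 2) ^ (q - 2) * q.factorial / (k * s ^ q) := by
  obtain ⟨b, rfl⟩ : ∃ b, v = b + 2 := ⟨v - 2, by omega⟩
  obtain ⟨a, rfl⟩ : ∃ a, q = a + 2 := ⟨q - 2, by omega⟩
  have hba : b ≤ a := by omega
  have hsub : a + 2 - (b + 2) = a - b := by omega
  have hq' : (a : ℝ) + 2 ≤ 2 * L := by exact_mod_cast hq
  have hca : c⁻¹ ^ (a - b) = c ^ b / c ^ a := by
    rw [inv_pow, eq_div_iff (by positivity), inv_mul_eq_iff_eq_mul₀ (by positivity), ← pow_add]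
    congr 1; omega
  rw [hsub, Nat.add_sub_cancel, le_div_iff₀ (by positivity), hca]
  push_cast
  have h1 := pow_div_factorial_le hba
  have h2 := vertex_edge_tradeoff (by norm_num) hL hlog (by positivity) hu (by positivity) hlam
    hba hq'
  have he : Real.exp 1 ≤ 3 := by linarith [Real.exp_one_lt_d9]
  have h3 : (4 * Real.exp 1) ^ a * (36 * (1 / 864)) ^ a ≤ (1 / 2 : ℝ) ^ a := by
    rw [← mul_pow]; gcongr; linarith
  set w := ((b : ℝ) + 2) ^ 2 / (a + 2) with hw
  calc ((b : ℝ) + 2) ^ (2 * (a + 2)) * (c ^ b / c ^ a * k⁻¹ ^ (b + 2)) * (k * s ^ (a + 2))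
      = ((b : ℝ) + 2) ^ (2 * (a + 2)) / (a + 2).factorial *
          (s ^ 2 / k * ((s / c) ^ a * (c / k) ^ b)) * (a + 2).factorial := by
        simp only [div_pow, inv_pow]
        field_simp
        ring
    _ ≤ 4 * Real.exp 1 ^ 2 * (4 * Real.exp 1 * w) ^ a *
          (s ^ 2 / k * ((s / c) ^ a * (c / k) ^ b)) * (a + 2).factorial := by gcongr
    _ = 4 * Real.exp 1 ^ 2 * (s ^ 2 / k) *
          ((4 * Real.exp 1) ^ a * ((w * (s / c)) ^ a * (c / k) ^ b)) * (a + 2).factorial := by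
        simp only [mul_pow]; ring
    _ ≤ 4 * Real.exp 1 ^ 2 * (s ^ 2 / k) *
          ((4 * Real.exp 1) ^ a * (36 * (1 / 864)) ^ a) * (a + 2).factorial := by gcongr
    _ ≤ _ := by gcongr

/-! ### The moment bound -/

section

variable {E T : Type*} [Fintype E] [DecidableEq E] [Fintype T] [DecidableEq T]

/-- The moment of order `p ≈ L` of the distortion, for independent ternary variables. The parameter
`s = 9 p / ε` makes `p! / s ^ p` at most `ε ^ p * exp (-2 p)`, as `9 ≥ exp 2`, and half of that
gain pays for the exponential. The constant `15552 = 18 * 864` makes the base `4 e * 36 / 864` of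
the geometric series at most `1 / 2`. -/
lemma ternaryExp_distortion_pow_le {L ε : ℝ} {c p : ℕ} (hL : 0 < L) (hlog : 1 ≤ Real.log L)
    (hε : 0 < ε) (hεL : ε ≤ 1 / L ^ 2) (hpL : L ≤ p) (hp : (p : ℝ) ≤ 2 * L)
    (hc : 15552 * (ε⁻¹ * (L / Real.log L) ^ 2) ≤ c)
    (hc' : (c : ℝ) ≤ 31104 * (ε⁻¹ * (L / Real.log L) ^ 2))
    (hk : 100000 * (ε⁻¹ ^ 2 * L) ≤ Fintype.card T)
    {y : E → ℝ} (hy : ∑ e, y e ^ 2 = 1) (hyc : ∀ e, y e ^ 2 ≤ (c : ℝ)⁻¹) :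
    ternaryExp (Fintype.card T : ℝ)⁻¹ (fun σ : T × E → SignType =>
        (∑ t, offDiagForm y fun e => (σ (t, e) : ℝ)) ^ p) ≤ ε ^ p * Real.exp (-L) := by
  set l := Real.log L with hl
  set k : ℝ := (Fintype.card T : ℝ) with hkdef
  have hl0 : 0 < l := by linarith
  have hk0 : 0 < k := lt_of_lt_of_le (by positivity) hk
  have hc0 : (0 : ℝ) < c := lt_of_lt_of_le (by positivity) hc
  have hp0 : (0 : ℝ) < p := by linarith
  set s : ℝ := 9 * p / ε with hs
  have hs0 : 0 < s := by positivity
  have hu : s / c ≤ 1 / 864 * l ^ 2 / L := by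
    rw [div_le_iff₀ hc0]
    calc s ≤ 9 * (2 * L) / ε := by rw [hs]; gcongr
      _ = 1 / 864 * l ^ 2 / L * (15552 * (ε⁻¹ * (L / l) ^ 2)) := by field_simp; norm_num
      _ ≤ _ := by gcongr
  have hlam : c / k ≤ 1 / L := by
    rw [div_le_iff₀ hk0]
    have h1 : ε * L ^ 2 ≤ 1 := by rwa [le_div_iff₀ (by positivity)] at hεL
    calc (c : ℝ) ≤ 31104 * (ε⁻¹ * (L / l) ^ 2) := hc'
      _ ≤ 31104 * (ε⁻¹ * (L / 1) ^ 2) := by gcongr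
      _ = 31104 * (ε⁻¹ ^ 2 * (ε * L ^ 2)) := by field_simp
      _ ≤ 100000 * (ε⁻¹ ^ 2 * 1) := by gcongr; norm_num
      _ = 1 / L * (100000 * (ε⁻¹ ^ 2 * L)) := by field_simp
      _ ≤ _ := by gcongr
  have hs2 : s ^ 2 / k ≤ 324 / 100000 * L := by
    rw [div_le_iff₀ hk0]
    calc s ^ 2 ≤ (9 * (2 * L) / ε) ^ 2 := by rw [hs]; gcongr
      _ = 324 / 100000 * L * (100000 * (ε⁻¹ ^ 2 * L)) := by field_simp; norm_num
      _ ≤ _ := by gcongr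
  set R := 4 * Real.exp 1 ^ 2 * (s ^ 2 / k) with hR
  have hR0 : 0 ≤ R := by positivity
  let B : ℕ → ℝ := fun q => R * (1 / 2) ^ (q - 2) * q.factorial / (k * s ^ q)
  have hmom : ∀ q ∈ Icc 2 p,
      ternaryExp k⁻¹ (fun σ : E → SignType => offDiagForm y (fun e => (σ e : ℝ)) ^ q) ≤
        Real.exp 1 * B q := by
    intro q hq
    rw [mem_Icc] at hq
    refine ternaryExp_offDiagForm_pow_le (by positivity) (by positivity) hy hyc (by omega)
      fun v hv hvq => ?_
    refine edge_vertex_term_le hL hlog hs0 hk0 hc0 hu hlam hv hvq (le_trans ?_ hp)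
    exact_mod_cast hq.2
  have hfirst : ternaryExp k⁻¹
      (fun σ : E → SignType => offDiagForm y (fun e => (σ e : ℝ)) ^ 1) ≤ 0 := by
    have := ternaryExp_offDiagForm_pow_le (θ := k⁻¹) (by positivity) le_rfl hy hyc le_rfl
      fun v h2 h1 => by omega
    simpa using this
  have hgeom : ∀ n : ℕ, ∑ q ∈ Icc 2 n, (1 / 2 : ℝ) ^ (q - 2) ≤ 2 := by
    intro n
    have h2 : Icc 2 n = Ico (0 + 2) (n - 1 + 2) := by ext; simp; omega
    rw [h2, ← sum_Ico_add' (fun q => (1 / 2 : ℝ) ^ (q - 2)) 0 (n - 1) 2, ← range_eq_Ico]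
    simp only [Nat.add_sub_cancel]
    exact sum_geometric_two_le _
  have hT : k * ∑ q ∈ Icc 2 p,
      ternaryExp k⁻¹ (fun σ : E → SignType => offDiagForm y (fun e => (σ e : ℝ)) ^ q) * s ^ q /
        q.factorial ≤ L := by
    calc _ ≤ k * ∑ q ∈ Icc 2 p, Real.exp 1 * B q * s ^ q / q.factorial := by
          gcongr with q hq
          exact hmom q hq
      _ = Real.exp 1 * R * ∑ q ∈ Icc 2 p, (1 / 2 : ℝ) ^ (q - 2) := by
          rw [mul_sum, mul_sum]
          refine sum_congr rfl fun q _ => ?_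
          simp only [B]
          field_simp
      _ ≤ Real.exp 1 * R * 2 := by gcongr; exact hgeom p
      _ ≤ 3 * (4 * 3 ^ 2 * (324 / 100000 * L)) * 2 := by
          have he : Real.exp 1 ≤ 3 := by linarith [Real.exp_one_lt_d9]
          rw [hR]; gcongr
      _ ≤ L := by linarith
  have hfac : (p.factorial : ℝ) * s⁻¹ ^ p ≤ ε ^ p * Real.exp (-2 * p) := by
    have h9 : Real.exp 2 ≤ 9 := by
      have : Real.exp 2 = Real.exp 1 ^ 2 := by rw [← Real.exp_nat_mul]; norm_num
      rw [this]; nlinarith [Real.exp_one_lt_d9, Real.exp_pos 1]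
    have h10 : (9 : ℝ)⁻¹ ≤ Real.exp (-2) := by rw [Real.exp_neg]; gcongr
    calc (p.factorial : ℝ) * s⁻¹ ^ p ≤ (p : ℝ) ^ p * s⁻¹ ^ p := by
          gcongr; exact_mod_cast Nat.factorial_le_pow p
      _ = ε ^ p * (9 : ℝ)⁻¹ ^ p := by
          rw [← mul_pow, ← mul_pow]; congr 1; rw [hs]; field_simp
      _ ≤ ε ^ p * Real.exp (-2) ^ p := by gcongr
      _ = _ := by rw [← Real.exp_nat_mul, mul_comm (p : ℝ)]
  calc _ ≤ p.factorial * s⁻¹ ^ p * Real.exp (k * ∑ q ∈ Icc 2 p,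
        ternaryExp k⁻¹ (fun σ : E → SignType => offDiagForm y (fun e => (σ e : ℝ)) ^ q) * s ^ q /
          q.factorial) :=
        ternaryExp_sum_rows_pow_le hs0 (fun σ => offDiagForm y (fun e => (σ e : ℝ)))
          (ternaryExp_offDiagForm_pow_nonneg (by positivity) y) hfirst p
    _ ≤ ε ^ p * Real.exp (-2 * p) * Real.exp L := by gcongr
    _ = ε ^ p * Real.exp (-2 * p + L) := by rw [mul_assoc, ← Real.exp_add]
    _ ≤ _ := by gcongr; linarith

end

/-! ### Sparse matrix-vector multiplication on the random access machine -/

/-- The program for the sparse matrix-vector product. Natural register `0` holds the number of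
coordinates of the vector, `1` the current one, `2` its index, `4` and `5` the current and the last
position in the column, and `6` the row; real register `0` holds the coordinate of the vector, `1`
the current summand, and `2` the updated coordinate of the output. Lines `0` to `9` are the loop
over the vector, lines `7` and `10` to `17` the loop over the column. -/
def mulProgram : Program :=
  [.jltN 1 0 2, .jmp 18, .loadN 2 0 1, .loadR 0 0 1, .loadN 4 1 2, .incN 2, .loadN 5 1 2,
   .jltN 4 5 10, .incN 1, .jmp 0,
   .loadN 6 2 4, .loadR 1 1 4, .mulR 1 1 0, .loadR 2 2 6, .addR 2 2 1, .storeR 2 6 2, .incN 4,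
   .jmp 7]

/-- The parts of the memory that the program only reads still hold the input. -/
structure HoldsInput (S : ColStore) (X : VecStore) (C : Config) : Prop where
  len : C.natReg 0 = X.len
  idx : C.natArr 0 = X.idx
  ptr : C.natArr 1 = S.ptr
  row : C.natArr 2 = S.row
  vec : C.realArr 0 = X.val
  mat : C.realArr 1 = S.val

/-- One pass through the loop over the column adds one entry of the matrix, times the current
coordinate of the vector, to the output. -/
lemma column_step {S : ColStore} {X : VecStore} {C : Config} (hC : HoldsInput S X C)
    (hpc : C.pc = 7) (hlt : C.natReg 4 < C.natReg 5) :
    ∃ C', (step mulProgram)^[9] C = C' ∧ HoldsInput S X C' ∧ C'.pc = 7 ∧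
      C'.natReg 1 = C.natReg 1 ∧ C'.natReg 4 = C.natReg 4 + 1 ∧ C'.natReg 5 = C.natReg 5 ∧
      C'.realReg 0 = C.realReg 0 ∧
      C'.realArr 2 = Function.update (C.realArr 2) (S.row (C.natReg 4))
        (C.realArr 2 (S.row (C.natReg 4)) + S.val (C.natReg 4) * C.realReg 0) := by
  obtain ⟨h1, h2, h3, h4, h5, h6⟩ := hC
  refine ⟨_, rfl, ?_⟩
  simp only [Function.iterate_succ, Function.iterate_zero, Function.comp, id]
  simp [step, mulProgram, exec, hpc, hlt, h4, h6]
  constructor <;> simp [*]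

/-- The loop over a column with `n` stored entries, up to and including the failing test. -/
lemma column_loop {S : ColStore} {X : VecStore} (n : ℕ) {C : Config} (hC : HoldsInput S X C)
    (hpc : C.pc = 7) (hn : C.natReg 5 = C.natReg 4 + n) :
    ∃ C', (step mulProgram)^[9 * n + 1] C = C' ∧ HoldsInput S X C' ∧ C'.pc = 8 ∧
      C'.natReg 1 = C.natReg 1 ∧
      ∀ t, C'.realArr 2 t = C.realArr 2 t + (∑ p ∈ Ico (C.natReg 4) (C.natReg 5),
        if S.row p = t then S.val p else 0) * C.realReg 0 := by
  induction n generalizing C with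
  | zero =>
    refine ⟨_, rfl, ?_⟩
    obtain ⟨h1, h2, h3, h4, h5, h6⟩ := hC
    simp [step, mulProgram, exec, hpc, hn]
    constructor <;> simp [*]
  | succ n ih =>
    have hlt : C.natReg 4 < C.natReg 5 := by omega
    obtain ⟨C₁, hs₁, hC₁, hpc₁, h1, h4, h5, hr, ha⟩ := column_step hC hpc hlt
    obtain ⟨C₂, hs₂, hC₂, hpc₂, h1', ha'⟩ := ih hC₁ hpc₁ (by omega)
    refine ⟨C₂, ?_, hC₂, hpc₂, h1'.trans h1, fun t => ?_⟩
    · rw [show 9 * (n + 1) + 1 = (9 * n + 1) + 9 by ring, Function.iterate_add_apply, hs₁, hs₂]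
    · rw [ha', ha, h4, h5, hr, sum_eq_sum_Ico_succ_bot hlt, Function.update_apply]
      by_cases ht : t = S.row (C.natReg 4)
      · subst ht; simp; ring
      · rw [if_neg ht, if_neg fun h => ht h.symm, zero_add]

/-- One pass through the loop over the vector: six instructions to load the coordinate and the
bounds of its column, the loop over the column, and two instructions to return to the test. -/
lemma coordinate_step {S : ColStore} {X : VecStore} {C : Config} (hC : HoldsInput S X C)
    (hpc : C.pc = 0) (hlt : C.natReg 1 < X.len)
    (hptr : S.ptr (X.idx (C.natReg 1)) ≤ S.ptr (X.idx (C.natReg 1) + 1)) :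
    ∃ C', (step mulProgram)^[9 * (S.ptr (X.idx (C.natReg 1) + 1) - S.ptr (X.idx (C.natReg 1))) + 9]
        C = C' ∧ HoldsInput S X C' ∧ C'.pc = 0 ∧ C'.natReg 1 = C.natReg 1 + 1 ∧
      ∀ t, C'.realArr 2 t = C.realArr 2 t +
        (∑ p ∈ Ico (S.ptr (X.idx (C.natReg 1))) (S.ptr (X.idx (C.natReg 1) + 1)),
          if S.row p = t then S.val p else 0) * X.val (C.natReg 1) := by
  set i := C.natReg 1 with hi
  have hload : ∃ C', (step mulProgram)^[6] C = C' ∧ HoldsInput S X C' ∧ C'.pc = 7 ∧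
      C'.natReg 1 = i ∧ C'.natReg 4 = S.ptr (X.idx i) ∧
      C'.natReg 5 = S.ptr (X.idx i + 1) ∧ C'.realReg 0 = X.val i ∧
      C'.realArr 2 = C.realArr 2 := by
    obtain ⟨h1, h2, h3, h4, h5, h6⟩ := hC
    have hlt' : C.natReg 1 < C.natReg 0 := by rw [h1]; exact hlt
    refine ⟨_, rfl, ?_⟩
    simp only [Function.iterate_succ, Function.iterate_zero, Function.comp, id]
    simp [step, mulProgram, exec, hpc, hlt', h2, h3, h5, hi]
    constructor <;> simp [*]
  obtain ⟨C₁, hs₁, hC₁, hpc₁, h1, h4, h5, hr, ha⟩ := hload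
  obtain ⟨C₂, hs₂, hC₂, hpc₂, h1', ha'⟩ := column_loop
    (S.ptr (X.idx i + 1) - S.ptr (X.idx i)) hC₁ hpc₁ (by omega)
  have hback : ∃ C', (step mulProgram)^[2] C₂ = C' ∧ HoldsInput S X C' ∧ C'.pc = 0 ∧
      C'.natReg 1 = C₂.natReg 1 + 1 ∧ C'.realArr 2 = C₂.realArr 2 := by
    obtain ⟨h1, h2, h3, h4, h5, h6⟩ := hC₂
    refine ⟨_, rfl, ?_⟩
    simp only [Function.iterate_succ, Function.iterate_zero, Function.comp, id]
    simp [step, mulProgram, exec, hpc₂]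
    constructor <;> simp [*]
  obtain ⟨C₃, hs₃, hC₃, hpc₃, h1'', ha''⟩ := hback
  refine ⟨C₃, ?_, hC₃, hpc₃, by omega, fun t => ?_⟩
  · rw [show ∀ n, 9 * n + 9 = 2 + ((9 * n + 1) + 6) by intro n; ring,
      Function.iterate_add_apply, Function.iterate_add_apply, hs₁, hs₂, hs₃]
  · rw [ha'', ha', ha, h4, h5, hr]

/-- The memory after the first `m` stored coordinates of the vector have been treated. -/
lemma vector_loop {S : ColStore} {X : VecStore} {c : ℕ}
    (hptr : ∀ i < X.len, S.ptr (X.idx i) ≤ S.ptr (X.idx i + 1) ∧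
      S.ptr (X.idx i + 1) - S.ptr (X.idx i) ≤ c)
    (m : ℕ) (hm : m ≤ X.len) :
    ∃ n C', n ≤ (9 * c + 9) * m ∧ (step mulProgram)^[n] (initConfig S X) = C' ∧
      HoldsInput S X C' ∧ C'.pc = 0 ∧ C'.natReg 1 = m ∧
      ∀ t, C'.realArr 2 t = ∑ i ∈ range m,
        (∑ p ∈ Ico (S.ptr (X.idx i)) (S.ptr (X.idx i + 1)),
          if S.row p = t then S.val p else 0) * X.val i := by
  induction m with
  | zero =>
    refine ⟨0, initConfig S X, by simp, rfl, ?_, rfl, by simp [initConfig], fun t => ?_⟩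
    · constructor <;> simp [initConfig]
    · simp [initConfig]
  | succ m ih =>
    obtain ⟨n, C, hn, hs, hC, hpc, h1, ha⟩ := ih (by omega)
    obtain ⟨hle, hcm⟩ := hptr m hm
    obtain ⟨C', hs', hC', hpc', h1', ha'⟩ := coordinate_step hC hpc (by omega)
      (by rw [h1]; exact hle)
    rw [h1] at hs' h1' ha'
    refine ⟨9 * (S.ptr (X.idx m + 1) - S.ptr (X.idx m)) + 9 + n, C', ?_, ?_, hC', hpc', h1',
      fun t => ?_⟩
    · calc _ ≤ (9 * c + 9) + (9 * c + 9) * m := by gcongr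
        _ = _ := by ring
    · rw [← hs] at hs'
      rw [← hs', ← Function.iterate_add_apply]
    · rw [ha', ha, sum_range_succ]

lemma VecStore.Represents.len_le {d : ℕ} {X : VecStore} {x : EuclideanSpace ℝ (Fin d)}
    (hX : X.Represents x) : X.len ≤ nnz x := by
  obtain ⟨h1, h2, -⟩ := hX
  choose j hj using h1
  have hinj : Set.InjOn (fun p : Fin X.len => j p p.2) Set.univ := by
    intro p _ q _ h
    have hp := (hj p p.2).1
    have hq := (hj q q.2).1
    exact Fin.ext (h2 p.2 q.2 (by rw [hp, hq]; exact congrArg Fin.val h))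
  have := Set.ncard_le_ncard_of_injOn (s := (Set.univ : Set (Fin X.len)))
    (t := {j : Fin d | x j ≠ 0}) (fun p => j p p.2) (fun p _ => (hj p p.2).2.2) hinj
  simpa [nnz, Set.ncard_univ] using this

lemma VecStore.Represents.sum_eq {d : ℕ} {X : VecStore} {x : EuclideanSpace ℝ (Fin d)}
    (hX : X.Represents x) (f : ℕ → ℝ) :
    ∑ i ∈ range X.len, f (X.idx i) * X.val i = ∑ j : Fin d, f j * x j := by
  obtain ⟨h1, h2, h3⟩ := hX
  choose j hj using h1
  rw [← sum_filter_of_ne (s := (univ : Finset (Fin d))) (p := fun j => x j ≠ 0)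
    fun j _ h => right_ne_zero_of_mul h]
  refine sum_bij (fun i hi => j i (mem_range.1 hi)) ?_ ?_ ?_ ?_
  · intro i hi
    simpa using (hj i (mem_range.1 hi)).2.2
  · intro p hp q hq h
    rw [mem_range] at hp hq
    exact h2 hp hq (by rw [(hj p hp).1, (hj q hq).1]; exact congrArg Fin.val h)
  · intro i hi
    obtain ⟨p, hp, hpi⟩ := h3 i (by simpa using hi)
    refine ⟨p, mem_range.2 hp, Fin.ext ?_⟩
    rw [← hpi, (hj p hp).1]
  · intro i hi
    rw [mem_range] at hi
    rw [(hj i hi).1, (hj i hi).2.1]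

lemma ColStore.Represents.card_le {d k : ℕ} {S : ColStore} {M : Matrix (Fin k) (Fin d) ℝ}
    (hS : S.Represents M) (j : Fin d) : S.ptr (j + 1) - S.ptr j ≤ colNnz M j := by
  obtain ⟨-, h1, h2, -⟩ := hS j
  choose t ht using h1
  have hinj : Set.InjOn (fun p : Set.Ico (S.ptr j) (S.ptr (j + 1)) => t p p.2) Set.univ := by
    intro p _ q _ h
    have hp := (ht p p.2).1
    have hq := (ht q q.2).1
    exact Subtype.ext (h2 p.2 q.2 (by rw [hp, hq]; exact congrArg Fin.val h))
  have := Set.ncard_le_ncard_of_injOn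
    (s := (Set.univ : Set (Set.Ico (S.ptr j) (S.ptr (j + 1)))))
    (t := {t : Fin k | M t j ≠ 0}) (fun p => t p p.2) (fun p _ => (ht p p.2).2.2) hinj
  simpa [colNnz, Set.ncard_univ] using this

lemma ColStore.Represents.sum_eq {d k : ℕ} {S : ColStore} {M : Matrix (Fin k) (Fin d) ℝ}
    (hS : S.Represents M) (j : Fin d) (t : Fin k) :
    ∑ p ∈ Ico (S.ptr j) (S.ptr (j + 1)), (if S.row p = t then S.val p else 0) = M t j := by
  obtain ⟨-, h1, h2, h3⟩ := hS j
  by_cases ht : M t j = 0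
  · rw [ht]
    refine sum_eq_zero fun p hp => ?_
    split_ifs with h
    · obtain ⟨t', ht', hv, -⟩ := h1 p (by simpa using hp)
      have : t' = t := Fin.ext (by rw [← ht', h])
      rw [hv, this, ht]
    · rfl
  · obtain ⟨p, hp, hpt⟩ := h3 t ht
    rw [sum_eq_single_of_mem p (by simpa using hp) fun q hq hqp => if_neg fun h =>
      hqp (h2 (by simpa using hq) hp (by rw [h, hpt])), if_pos hpt]
    obtain ⟨t', ht', hv, -⟩ := h1 p hp
    have : t' = t := Fin.ext (by rw [← ht', hpt])
    rw [hv, this]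

/-- The time bound counts two more steps for the failing test of the loop over the vector and the
jump out of the program. -/
lemma computesProduct_mulProgram {d k c : ℕ} {M : Matrix (Fin k) (Fin d) ℝ}
    (hM : ∀ j, colNnz M j ≤ c) (x : EuclideanSpace ℝ (Fin d)) :
    ComputesProduct mulProgram M x (((9 * c + 9) * nnz x + 2 : ℕ) : ℝ) := by
  intro S X hS hX
  have hptr : ∀ i < X.len, S.ptr (X.idx i) ≤ S.ptr (X.idx i + 1) ∧
      S.ptr (X.idx i + 1) - S.ptr (X.idx i) ≤ c := by
    intro i hi
    obtain ⟨j, hj, -⟩ := hX.1 i hi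
    rw [hj]
    exact ⟨(hS j).1, (hS.card_le j).trans (hM j)⟩
  obtain ⟨n, C, hn, hs, hC, hpc, h1, ha⟩ := vector_loop hptr X.len le_rfl
  have hnlt : ¬ C.natReg 1 < C.natReg 0 := by rw [hC.len, h1]; exact lt_irrefl _
  have hend : ∃ C', (step mulProgram)^[2] C = C' ∧ C'.pc = 18 ∧ C'.realArr = C.realArr := by
    refine ⟨_, rfl, ?_⟩
    simp only [Function.iterate_succ, Function.iterate_zero, Function.comp, id]
    simp [step, mulProgram, exec, hpc, hnlt]
  obtain ⟨C', hs', hpc', ha'⟩ := hend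
  refine ⟨C', ⟨n + 2, ?_, ?_, ?_⟩, fun t => ?_⟩
  · have : n ≤ (9 * c + 9) * nnz x := hn.trans (Nat.mul_le_mul_left _ hX.len_le)
    exact_mod_cast Nat.add_le_add_right this 2
  · rw [add_comm, Function.iterate_add_apply, hs, hs']
  · rw [hpc']; rfl
  · rw [ha', ha, hX.sum_eq fun j => ∑ p ∈ Ico (S.ptr j) (S.ptr (j + 1)),
      if S.row p = t then S.val p else 0]
    simp only [hS.sum_eq]
    rfl

/-! ### Existence of seeds -/

/-- The coordinates of a uniformly distributed vector are independent; here the vector is a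
measure preserving function of the sample point. -/
lemma wiseIndep_eval {Ω ι β : Type*} [MeasurableSpace Ω] [MeasurableSpace β] [Fintype ι]
    {P : Measure Ω} [IsProbabilityMeasure P] {m : Measure β} [IsProbabilityMeasure m] {f : Ω → ι → β}
    (hf : MeasurePreserving f P (Measure.pi fun _ => m)) (r : ℕ) :
    WiseIndep r (fun i ω => f ω i) P := by
  classical
  have h : iIndepFun (fun i ω => f ω i) P := by
    have hm : ∀ i, AEMeasurable (fun ω => f ω i) P :=
      fun i => ((measurable_pi_apply i).comp hf.measurable).aemeasurable
    rw [iIndepFun_iff_map_fun_eq_pi_map hm]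
    have h1 : ∀ i, P.map (fun ω => f ω i) = m := fun i =>
      ((measurePreserving_eval (fun _ : ι => m) i).comp hf).map_eq
    simp only [h1]
    exact hf.map_eq
  exact fun S _ => h.precomp Subtype.val_injective

/-- Mutually independent uniform entries form a seed, whatever the order of independence. -/
lemma exists_isSeedLaw {d k c : ℕ} (hk : 0 < k) (r : ℕ) :
    ∃ ν : Measure (Seed d k c), IsSeedLaw r ν := by
  have : Nonempty (Fin k) := ⟨⟨0, hk⟩⟩
  let mh : Measure (Fin k) := uniformOn Set.univ
  let ms : Measure Bool := uniformOn Set.univ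
  have : IsProbabilityMeasure mh := isProbabilityMeasure_uniformOn Set.finite_univ Set.univ_nonempty
  have : IsProbabilityMeasure ms := isProbabilityMeasure_uniformOn Set.finite_univ Set.univ_nonempty
  let H : Measure (Fin d × Fin c → Fin k) := Measure.pi fun _ => mh
  let S : Measure (Fin d × Fin c → Bool) := Measure.pi fun _ => ms
  have h1 : MeasurePreserving Prod.fst (H.prod S) H := measurePreserving_fst
  have h2 : MeasurePreserving Prod.snd (H.prod S) S := measurePreserving_snd
  refine ⟨H.prod S, inferInstance, fun e t => ?_, fun e b => ?_, wiseIndep_eval h1 r,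
    wiseIndep_eval h2 r, ?_⟩
  · have h := ((measurePreserving_eval (fun _ => mh) e).comp h1).measure_preimage
      (measurableSet_singleton t).nullMeasurableSet
    refine h.trans ?_
    simp [mh, uniformOn_univ]
  · have h := ((measurePreserving_eval (fun _ => ms) e).comp h2).measure_preimage
      (measurableSet_singleton b).nullMeasurableSet
    refine h.trans ?_
    rw [uniformOn_univ]
    simp
  · exact indepFun_prod measurable_id measurable_id

/-! ### The sparse matrix -/

section

variable {d k c : ℕ}

lemma sparseMatrix_apply (ω : Seed d k c) (t : Fin k) (j : Fin d) :
    sparseMatrix ω t j = (Real.sqrt c)⁻¹ * ∑ a, entry ω (t, (j, a)) := rfl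

lemma colNnz_sparseMatrix_le (ω : Seed d k c) (j : Fin d) : colNnz (sparseMatrix ω) j ≤ c := by
  have h : {t | sparseMatrix ω t j ≠ 0} ⊆
      ((univ.image fun a : Fin c => ω.1 (j, a) : Finset (Fin k)) : Set (Fin k)) := by
    intro t ht
    by_contra hn
    refine ht ?_
    rw [sparseMatrix_apply, sum_eq_zero, mul_zero]
    intro a _
    rw [entry_eq, if_neg]
    rintro rfl
    exact hn (by simp)
  calc _ ≤ _ := Set.ncard_le_ncard h (Set.toFinite _)
    _ ≤ c := by
      rw [Set.ncard_coe_finset]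
      exact card_image_le.trans (by simp)

instance : MeasurableSingletonClass (Matrix (Fin k) (Fin d) ℝ) :=
  inferInstanceAs (MeasurableSingletonClass (Fin k → Fin d → ℝ))

lemma sum_entry_sq (ω : Seed d k c) (e : Fin d × Fin c) : ∑ t, entry ω (t, e) ^ 2 = 1 := by
  simp only [entry_eq]
  rw [sum_eq_single (ω.1 e) (fun t _ ht => by rw [if_neg fun h => ht h.symm]; simp)
    fun h => absurd (mem_univ _) h, if_pos rfl, sq, sgn_mul_self]

/-- The vector `x / ‖x‖` with every coordinate duplicated `c` times and rescaled. -/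
def spread (c : ℕ) (x : EuclideanSpace ℝ (Fin d)) (e : Fin d × Fin c) : ℝ :=
  x e.1 / (Real.sqrt c * ‖x‖)

lemma spread_sq (x : EuclideanSpace ℝ (Fin d)) (e : Fin d × Fin c) :
    spread c x e ^ 2 = (c : ℝ)⁻¹ * (x e.1 ^ 2 / ‖x‖ ^ 2) := by
  rw [spread, div_pow, mul_pow, Real.sq_sqrt (Nat.cast_nonneg c)]
  field_simp

lemma spread_sq_le (x : EuclideanSpace ℝ (Fin d)) (e : Fin d × Fin c) :
    spread c x e ^ 2 ≤ (c : ℝ)⁻¹ := by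
  rw [spread_sq]
  refine mul_le_of_le_one_right (by positivity) (div_le_one_of_le₀ ?_ (by positivity))
  rw [EuclideanSpace.real_norm_sq_eq]
  exact single_le_sum (f := fun j => x j ^ 2) (fun j _ => sq_nonneg _) (mem_univ e.1)

lemma sum_spread_sq (hc : 0 < c) {x : EuclideanSpace ℝ (Fin d)} (hx : x ≠ 0) :
    ∑ e, spread c x e ^ 2 = 1 := by
  simp only [spread_sq]
  have hx' : ‖x‖ ^ 2 ≠ 0 := by simpa using hx
  have hc' : (c : ℝ) ≠ 0 := by exact_mod_cast hc.ne'
  rw [Fintype.sum_prod_type]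
  simp only [sum_const, card_univ, Fintype.card_fin, nsmul_eq_mul]
  rw [← mul_sum, ← mul_sum, ← sum_div, ← EuclideanSpace.real_norm_sq_eq, div_self hx',
    mul_one, mul_inv_cancel₀ hc']

/-- The distortion of the squared norm is the sum over the rows of off-diagonal forms. -/
lemma norm_apply_sparseMatrix_sq (hc : 0 < c) (ω : Seed d k c) {x : EuclideanSpace ℝ (Fin d)}
    (hx : x ≠ 0) :
    ‖apply (sparseMatrix ω) x‖ ^ 2 =
      ‖x‖ ^ 2 * (1 + ∑ t, offDiagForm (spread c x) fun e => entry ω (t, e)) := by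
  have hx' : ‖x‖ ≠ 0 := by simpa using hx
  have hrow : ∀ t, apply (sparseMatrix ω) x t = ‖x‖ * ∑ e, spread c x e * entry ω (t, e) := by
    intro t
    change ∑ j, sparseMatrix ω t j * x j = _
    rw [Fintype.sum_prod_type, mul_sum]
    refine sum_congr rfl fun j _ => ?_
    rw [sparseMatrix_apply, mul_sum, mul_sum, sum_mul]
    refine sum_congr rfl fun a _ => ?_
    rw [spread]
    field_simp
  rw [EuclideanSpace.real_norm_sq_eq]
  simp only [hrow, mul_pow, ← mul_sum]
  congr 1
  simp only [offDiagForm_eq, sum_sub_distrib]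
  rw [sum_comm (f := fun t e => spread c x e ^ 2 * entry ω (t, e) ^ 2)]
  simp only [← mul_sum, sum_entry_sq, mul_one, sum_spread_sq hc hx]
  ring

lemma norm_bounds_of_distortion_le {a b z ε : ℝ} (ha : 0 ≤ a) (hb : 0 ≤ b) (hε : 0 ≤ ε)
    (hε1 : ε ≤ 1) (h : b ^ 2 = a ^ 2 * (1 + z)) (hz : |z| ≤ ε) :
    (1 - ε) * a ≤ b ∧ b ≤ (1 + ε) * a := by
  obtain ⟨h1, h2⟩ := abs_le.1 hz
  constructor
  · refine le_of_sq_le_sq ?_ hb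
    rw [h, mul_pow, mul_comm]
    gcongr
    nlinarith
  · refine le_of_sq_le_sq ?_ (by positivity)
    rw [h, mul_pow, mul_comm]
    gcongr
    nlinarith

/-! ### Concentration -/

/-- Markov's inequality for an even moment. -/
lemma one_sub_le_measure_abs_le {Ω : Type*} [MeasurableSpace Ω] {ν : Measure Ω}
    [IsProbabilityMeasure ν] {Z : Ω → ℝ} (hZ : Measurable Z) {p : ℕ} (hp : Even p) {ε δ : ℝ}
    (hint : Integrable (fun ω => Z ω ^ p) ν)
    (hε : 0 < ε) (h : ∫ ω, Z ω ^ p ∂ν ≤ ε ^ p * δ) :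
    ENNReal.ofReal (1 - δ) ≤ ν {ω | |Z ω| ≤ ε} := by
  have hm : MeasurableSet {ω | |Z ω| ≤ ε} := measurableSet_le hZ.abs measurable_const
  have h1 := mul_meas_ge_le_integral_of_nonneg
    (ae_of_all ν fun ω => hp.pow_nonneg (Z ω)) hint (ε ^ p)
  have h2 : ν.real {ω | ε ^ p ≤ Z ω ^ p} ≤ δ :=
    le_of_mul_le_mul_left (h1.trans h) (by positivity)
  have h3 : ν.real {ω | |Z ω| ≤ ε}ᶜ ≤ δ := by
    refine (measureReal_mono fun ω hω => ?_).trans h2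
    have : ε < |Z ω| := by simpa using hω
    change ε ^ p ≤ Z ω ^ p
    rw [← hp.pow_abs (Z ω)]
    gcongr
  rw [probReal_compl_eq_one_sub hm] at h3
  rw [← ofReal_measureReal]
  exact ENNReal.ofReal_le_ofReal (by linarith)

/-- The matrix preserves the norm of a fixed vector with the required probability. -/
lemma one_sub_le_measure_norm_bounds {L ε : ℝ} {r : ℕ} (hL : 2 ≤ L) (hlog : 1 ≤ Real.log L)
    (hε : 0 < ε) (hε1 : ε ≤ 1) (hεL : ε ≤ 1 / L ^ 2)
    (hc : 15552 * (ε⁻¹ * (L / Real.log L) ^ 2) ≤ c)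
    (hc' : (c : ℝ) ≤ 31104 * (ε⁻¹ * (L / Real.log L) ^ 2))
    (hk : 100000 * (ε⁻¹ ^ 2 * L) ≤ k) (hr : 4 * L ≤ r)
    {ν : Measure (Seed d k c)} (hν : IsSeedLaw r ν) (x : EuclideanSpace ℝ (Fin d)) :
    ENNReal.ofReal (1 - Real.exp (-L)) ≤ ν {ω | (1 - ε) * ‖x‖ ≤ ‖apply (sparseMatrix ω) x‖ ∧
      ‖apply (sparseMatrix ω) x‖ ≤ (1 + ε) * ‖x‖} := by
  have := hν.prob
  have hL0 : 0 < L := by linarith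
  rcases eq_or_ne x 0 with rfl | hx
  · have h0 : ∀ ω : Seed d k c, apply (sparseMatrix ω) 0 = 0 := fun ω => by simp [apply]
    simp only [h0, norm_zero, mul_zero, le_refl, and_self, Set.ofPred_true, measure_univ]
    rw [ENNReal.ofReal_le_one]
    linarith [Real.exp_pos (-L)]
  have hc0 : 0 < c := by
    have : (0 : ℝ) < c := lt_of_lt_of_le (by positivity) hc
    exact_mod_cast this
  set n := ⌈L / 2⌉₊ with hn
  have hn1 : L / 2 ≤ n := Nat.le_ceil _
  have hn2 : (n : ℝ) < L / 2 + 1 := Nat.ceil_lt_add_one (by positivity)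
  have hpL : L ≤ ((2 * n : ℕ) : ℝ) := by push_cast; linarith
  have hp : ((2 * n : ℕ) : ℝ) ≤ 2 * L := by push_cast; linarith
  have hpr : 2 * (2 * n) ≤ r := by
    have : ((2 * (2 * n) : ℕ) : ℝ) ≤ r := by push_cast at hp ⊢; linarith
    exact_mod_cast this
  have htern := ternaryExp_distortion_pow_le (T := Fin k) hL0 hlog hε hεL hpL hp hc hc'
    (by simpa using hk) (sum_spread_sq hc0 hx) (spread_sq_le x)
  rw [Fintype.card_fin] at htern
  have hmom := (integral_sum_offDiagForm_pow_le hν hpr (spread c x)).trans htern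
  refine (one_sub_le_measure_abs_le (measurable_of_countable _) (even_two_mul n)
    Integrable.of_finite hε hmom).trans (measure_mono fun ω hω => ?_)
  exact norm_bounds_of_distortion_le (norm_nonneg _) (norm_nonneg _) hε.le hε1
    (norm_apply_sparseMatrix_sq hc0 ω hx) hω

/-! ### The choice of the column sparsity -/

lemma sparsity_choice {L ε : ℝ} (hε : 0 < ε) (hε1 : ε < 1) (hL : Real.exp (Real.exp 1) ≤ L) :
    2 ≤ L ∧ 1 ≤ Real.log L ∧ 1 ≤ ε⁻¹ * (L / Real.log L) ^ 2 ∧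
      ε⁻¹ * (L / Real.log L) ^ 2 ≤
        ε⁻¹ * (L * Real.log (Real.log L) / Real.log L) ^ 2 := by
  have he : 1 ≤ Real.exp 1 := by linarith [Real.exp_one_gt_d9]
  have hL2 : 2 ≤ L := by linarith [Real.add_one_le_exp (Real.exp 1)]
  have hl : Real.exp 1 ≤ Real.log L := by
    rw [Real.le_log_iff_exp_le (by linarith)]; exact hL
  have hl1 : 1 ≤ Real.log L := he.trans hl
  have hll : 1 ≤ Real.log (Real.log L) := by
    rw [Real.le_log_iff_exp_le (by linarith)]; exact hl
  have hlL : Real.log L ≤ L := (Real.log_le_sub_one_of_pos (by linarith)).trans (by linarith)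
  refine ⟨hL2, hl1, ?_, ?_⟩
  · have h1 : 1 ≤ L / Real.log L := by rwa [one_le_div (by linarith)]
    have h2 : 1 ≤ ε⁻¹ := (one_le_inv₀ hε).2 hε1.le
    exact one_le_mul_of_one_le_of_one_le h2 (one_le_pow₀ h1)
  · gcongr
    exact le_mul_of_one_le_right (by linarith) hll

end

end SparseJL

end

theorem theorem2 :
    ∃ γ α β ρ τ : ℝ, 0 < γ ∧ 0 < α ∧ 0 < β ∧ 0 < ρ ∧ 0 < τ ∧ ∃ P : SparseJL.Program,
      ∀ ε δ : ℝ, 0 < ε → ε < 1 → 0 < δ → δ < 1 → ε ≤ 1 / (Real.log (1 / δ)) ^ 2 →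
      ∃ c : ℕ, 0 < c ∧
        (δ ≤ Real.exp (-Real.exp (Real.exp 1)) → (c : ℝ) ≤ β * SparseJL.sparsityBound ε δ) ∧
        ∀ d k r : ℕ, α * (ε⁻¹ ^ 2 * Real.log (1 / δ)) ≤ k → ρ * Real.log (1 / δ) ≤ r →
          (∃ ν : Measure (SparseJL.Seed d k c), SparseJL.IsSeedLaw r ν) ∧
          ∀ ν : Measure (SparseJL.Seed d k c), SparseJL.IsSeedLaw r ν →
            ∃ D : Measure (Matrix (Fin k) (Fin d) ℝ),
              D = ν.map SparseJL.sparseMatrix ∧ IsProbabilityMeasure D ∧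
              (∀ x : EuclideanSpace ℝ (Fin d),
                ENNReal.ofReal (1 - γ * δ) ≤
                  D {M | (1 - ε) * ‖x‖ ≤ ‖SparseJL.apply M x‖ ∧
                    ‖SparseJL.apply M x‖ ≤ (1 + ε) * ‖x‖}) ∧
              (∀ᵐ M ∂D, ∀ j : Fin d, SparseJL.colNnz M j ≤ c) ∧
              (δ ≤ Real.exp (-Real.exp (Real.exp 1)) →
                ∀ᵐ M ∂D, ∀ x : EuclideanSpace ℝ (Fin d),
                  SparseJL.ComputesProduct P M x
                    (τ * SparseJL.sparsityBound ε δ * max 1 (SparseJL.nnz x : ℝ))) := by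
  refine ⟨Real.exp (Real.exp (Real.exp 1)), 100000, 31104, 4, 622080, Real.exp_pos _, by norm_num,
    by norm_num, by norm_num, by norm_num, SparseJL.mulProgram, ?_⟩
  intro ε δ hε hε1 hδ hδ1 hεL
  have hL0 : 0 < Real.log (1 / δ) := Real.log_pos (by rw [lt_div_iff₀ hδ]; linarith)
  have hexpL : Real.exp (-Real.log (1 / δ)) = δ := by
    rw [one_div, Real.log_inv, neg_neg, Real.exp_log hδ]
  -- Only the bound on `c` and the concentration depend on how small `δ` is.
  suffices H : ∃ c : ℕ, 0 < c ∧
      (δ ≤ Real.exp (-Real.exp (Real.exp 1)) → (c : ℝ) ≤ 31104 * SparseJL.sparsityBound ε δ) ∧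
      ∀ d k r : ℕ, 100000 * (ε⁻¹ ^ 2 * Real.log (1 / δ)) ≤ k → 4 * Real.log (1 / δ) ≤ r →
        ∀ ν : Measure (SparseJL.Seed d k c), SparseJL.IsSeedLaw r ν →
          ∀ x : EuclideanSpace ℝ (Fin d),
            ENNReal.ofReal (1 - Real.exp (Real.exp (Real.exp 1)) * δ) ≤
              ν {ω | (1 - ε) * ‖x‖ ≤ ‖SparseJL.apply (SparseJL.sparseMatrix ω) x‖ ∧
                ‖SparseJL.apply (SparseJL.sparseMatrix ω) x‖ ≤ (1 + ε) * ‖x‖} by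
    obtain ⟨c, hc0, hcB, hconc⟩ := H
    refine ⟨c, hc0, hcB, fun d k r hk hr => ⟨SparseJL.exists_isSeedLaw ?_ r, fun ν hν => ?_⟩⟩
    · have : (0 : ℝ) < k := lt_of_lt_of_le (by positivity) hk
      exact_mod_cast this
    · have := hν.prob
      have hmeas : Measurable (SparseJL.sparseMatrix (d := d) (k := k) (c := c)) :=
        measurable_of_countable _
      have hrange : ∀ᵐ M ∂ν.map SparseJL.sparseMatrix, M ∈ Set.range SparseJL.sparseMatrix :=
        ae_map_mem_range _ (Set.finite_range _).measurableSet _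
      have hcol : ∀ᵐ M ∂ν.map SparseJL.sparseMatrix, ∀ j : Fin d, SparseJL.colNnz M j ≤ c := by
        filter_upwards [hrange] with M hM
        obtain ⟨ω, rfl⟩ := hM
        exact SparseJL.colNnz_sparseMatrix_le ω
      refine ⟨_, rfl, Measure.isProbabilityMeasure_map hmeas.aemeasurable, fun x => ?_, hcol,
        fun hδe => ?_⟩
      · exact (hconc d k r hk hr ν hν x).trans (Measure.le_map_apply hmeas.aemeasurable _)
      · filter_upwards [hcol] with M hM x S X hS hX
        obtain ⟨C, ⟨n, hn, hrun⟩, hC⟩ := SparseJL.computesProduct_mulProgram hM x S X hS hX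
        refine ⟨C, ⟨n, hn.trans ?_, hrun⟩, hC⟩
        have hc1 : (1 : ℝ) ≤ c := by exact_mod_cast hc0
        set w : ℝ := max 1 (SparseJL.nnz x : ℝ) with hw
        have hw1 : 1 ≤ w := le_max_left _ _
        have hcw : 1 ≤ (c : ℝ) * w := one_le_mul_of_one_le_of_one_le hc1 hw1
        push_cast
        calc (9 * (c : ℝ) + 9) * SparseJL.nnz x + 2
            ≤ (9 * (c : ℝ) + 9 * c) * w + 2 * (c * w) := by
              gcongr
              · linarith
              · exact le_max_right _ _
              · linarith
          _ = 20 * c * w := by ring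
          _ ≤ 20 * (31104 * SparseJL.sparsityBound ε δ) * w := by
              gcongr
              exact hcB hδe
          _ = _ := by ring
  by_cases hδe : δ ≤ Real.exp (-Real.exp (Real.exp 1))
  · have hL : Real.exp (Real.exp 1) ≤ Real.log (1 / δ) := by
      rw [one_div, Real.log_inv, le_neg, Real.log_le_iff_le_exp hδ]
      exact hδe
    obtain ⟨hL2, hl1, hX1, hXB⟩ := SparseJL.sparsity_choice hε hε1 hL
    set Y := ε⁻¹ * (Real.log (1 / δ) / Real.log (Real.log (1 / δ))) ^ 2 with hY
    have hc1 : 15552 * Y ≤ (⌈15552 * Y⌉₊ : ℝ) := Nat.le_ceil _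
    have hc2 : (⌈15552 * Y⌉₊ : ℝ) ≤ 31104 * Y := by
      have := Nat.ceil_lt_add_one (a := 15552 * Y) (by positivity)
      linarith
    refine ⟨⌈15552 * Y⌉₊, Nat.ceil_pos.2 (by positivity), fun _ => ?_, ?_⟩
    · exact hc2.trans (by rw [SparseJL.sparsityBound]; gcongr)
    · intro d k r hk hr ν hν x
      refine le_trans (ENNReal.ofReal_le_ofReal ?_)
        (SparseJL.one_sub_le_measure_norm_bounds hL2 hl1 hε hε1.le hεL hc1 hc2 hk hr hν x)
      rw [hexpL]
      have : 1 ≤ Real.exp (Real.exp (Real.exp 1)) := Real.one_le_exp (Real.exp_pos _).le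
      nlinarith
  · -- For such `δ` the constant `exp (exp (exp 1))` makes the allowed failure probability at least `1`.
    refine ⟨1, one_pos, fun h => absurd h hδe, fun d k r _ _ ν _ x => ?_⟩
    rw [ENNReal.ofReal_of_nonpos]
    · exact zero_le
    · rw [not_le] at hδe
      have h1 := mul_lt_mul_of_pos_left hδe (Real.exp_pos (Real.exp (Real.exp 1)))
      rw [← Real.exp_add, add_neg_cancel, Real.exp_zero] at h1
      linarith
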